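/- **Theorem.** Put rewards $(r(v))_{v\in\mathbb N^2}$ on the vertices of the directed lattice $\mathbb N^2$ (edges $v\to v+(1,0)$ and $v\to v+(0,1)$), independent and Pareto distributed: $\mathbb P(r(v)\le x)=1-(x_m/x)^\alpha$ for $x\ge x_m$ and $0$ for $x<x_m$, where $x_m>0$ and $\alpha\in(0,2)$. Let $T^*_2(v,n)$ be the maximum, over directed paths that start at $v$ and take $n$ steps, of the sum of the rewards of the $n$ vertices reached (the start vertex is not counted), and let $R^*_2(n)=T^*_2(\mathbf 0,n)/n$. For a sensing range $m\ge 1$, the iterative planner starts at $v_0=\mathbf 0$ and, in its $k$-th iteration, follows a maximum-reward $m$-step path from $v_{k-1}$, whose last vertex is $v_k$ (ties are broken arbitrarily); let $$R_{\mathrm{iterative}}(n;m)=\frac1n\sum_{k=1}^{\lfloor n/m\rfloor}T^*_2(v_{k-1},m).$$ 1. There exist a probability space $(\Omega,\mathcal F,P)$ and reward fields $r_1,r_2,\dots$ on it, each $r_n$ being a family of independent Pareto rewards as above (no joint law of different $r_n$ is prescribed), such that, for every $M:\mathbb N\to\mathbb N$ with $M(n)\ge1$ for $n\ge1$ and $\lim_{n\to\infty}M(n)/n=0$,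 if $R_{\mathrm{iterative}}(n;M(n))$ and $R^*_2(n)$ are computed from the rewards $r_n$, then almost surely $$\lim_{n\to\infty}\frac{R_{\mathrm{iterative}}(n;M(n))}{R^*_2(n)}=0,$$ where the limit is along those $n$ that are multiples of $M(n)$. 2. If both mean rewards are computed, for all $n$, from one and the same field $r$ of independent Pareto rewards as above, on an arbitrary probability space, then for every such $M$ the ratio $R_{\mathrm{iterative}}(n;M(n))/R^*_2(n)$ tends to $0$ in probability as $n\to\infty$ (along all $n$). -/

import Mathlib

open MeasureTheory ProbabilityTheory Filter Topology

/-- The edge relation of the two-dimensional directed regular lattice on `ℕ × ℕ`: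
one coordinate is increased by one. -/
def LatticeEdge (u v : ℕ × ℕ) : Prop :=
  v = (u.1 + 1, u.2) ∨ v = (u.1, u.2 + 1)

/-- The set of directed lattice paths with `n` steps that start at `v₀`. -/
def latticePaths (v₀ : ℕ × ℕ) (n : ℕ) : Set (Fin (n + 1) → ℕ × ℕ) :=
  {p | p 0 = v₀ ∧ ∀ i : Fin n, LatticeEdge (p i.castSucc) (p i.succ)}

/-- The total reward of a path with `n` steps: the sum of the rewards of the `n` vertices that it
reaches. The start vertex is not counted, so that rewards add up under concatenation of paths. -/
noncomputable def pathReward (r : ℕ × ℕ → ℝ) {n : ℕ} (p : Fin (n + 1) → ℕ × ℕ) : ℝ :=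
  ∑ i : Fin n, r (p i.succ)

/-- The maximum total reward of a path with `n` steps from `v₀`. It is a maximum over a finite
nonempty set, see `isGreatest_maxReward`. -/
noncomputable def maxReward (r : ℕ × ℕ → ℝ) (v₀ : ℕ × ℕ) (n : ℕ) : ℝ :=
  sSup (pathReward r '' latticePaths v₀ n)

/-- `v 0, v 1, v 2, …` are the vertices at which the iterations of the planner with sensing range
`m` start: `v 0` is the origin, and `v (k + 1)` is the end of a maximum-reward path with `m` steps
from `v k` (ties are broken in any way). -/
def IsPlannerRun (r : ℕ × ℕ → ℝ) (m : ℕ) (v : ℕ → ℕ × ℕ) : Prop :=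
  v 0 = (0, 0) ∧ ∀ k, ∃ p ∈ latticePaths (v k) m,
    pathReward r p = maxReward r (v k) m ∧ p (Fin.last m) = v (k + 1)

/-- The mean reward collected in `n` steps by the planner with sensing range `m` along the run `v`.
The number `n / m` of iterations is exact when `m` divides `n` (otherwise it is rounded down). -/
noncomputable def iterativeMeanReward (r : ℕ × ℕ → ℝ) (v : ℕ → ℕ × ℕ) (n m : ℕ) : ℝ :=
  (∑ k ∈ Finset.range (n / m), maxReward r (v k) m) / (n : ℝ)

/-- The optimal mean reward in `n` steps from the origin. -/
noncomputable def optimalMeanReward (r : ℕ × ℕ → ℝ) (n : ℕ) : ℝ :=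
  maxReward r (0, 0) n / (n : ℝ)

/-- A field of independent random rewards, one for each vertex of the lattice, each with the Pareto
distribution with scale `xm` and index `α`. -/
structure IsParetoField {Ω : Type*} [MeasurableSpace Ω] (P : Measure Ω) (xm α : ℝ)
    (r : Ω → ℕ × ℕ → ℝ) : Prop where
  measurable : ∀ v, Measurable fun ω => r ω v
  indep : iIndepFun (fun v ω => r ω v) P
  law : ∀ v, P.map (fun ω => r ω v) = paretoMeasure xm α

/-- The sensing range is a sublinear function of the distance. -/
def IsSublinear (M : ℕ → ℕ) : Prop :=
  Tendsto (fun n => (M n : ℝ) / (n : ℝ)) atTop (𝓝 0)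

theorem latticePaths_nonempty (v₀ : ℕ × ℕ) (n : ℕ) : (latticePaths v₀ n).Nonempty :=
  ⟨fun i => (v₀.1 + i, v₀.2), by simp, fun i => Or.inl (by simp [add_assoc])⟩

theorem latticePaths_finite (v₀ : ℕ × ℕ) (n : ℕ) : (latticePaths v₀ n).Finite := by
  have h : ∀ p ∈ latticePaths v₀ n, ∀ i : Fin (n + 1), p i ≤ (v₀.1 + i, v₀.2 + i) := by
    rintro p ⟨h0, hs⟩ i
    induction i using Fin.induction with
    | zero => simp [h0]
    | succ i ih =>
      have h1 := Prod.le_def.1 ih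
      rcases hs i with h | h <;> rw [h] <;> simp only [Prod.le_def, Fin.val_succ] <;>
        simp only [Fin.val_castSucc] at h1 <;> omega
  refine Set.Finite.subset
    (Set.Finite.pi' fun i : Fin (n + 1) => Set.finite_Iic (v₀.1 + (i : ℕ), v₀.2 + (i : ℕ))) ?_
  exact fun p hp i => h p hp i

theorem isGreatest_maxReward (r : ℕ × ℕ → ℝ) (v₀ : ℕ × ℕ) (n : ℕ) :
    IsGreatest (pathReward r '' latticePaths v₀ n) (maxReward r v₀ n) := by
  have hf := (latticePaths_finite v₀ n).image (pathReward r)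
  exact ⟨((latticePaths_nonempty v₀ n).image _).csSup_mem hf,
    fun _ hx => le_csSup hf.bddAbove hx⟩

theorem exists_isPlannerRun (r : ℕ × ℕ → ℝ) (m : ℕ) : ∃ v, IsPlannerRun r m v := by
  choose p hp hr using fun v => (isGreatest_maxReward r v m).1
  refine ⟨fun k => (fun v => p v (Fin.last m))^[k] (0, 0), rfl, fun k => ⟨p _, hp _, hr _, ?_⟩⟩
  exact (Function.iterate_succ_apply' (fun v => p v (Fin.last m)) k (0, 0)).symm

/-! The scale of the problem is `n ^ (2 / α)`. About `n ^ 2` vertices lie within `n` steps of the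
origin, so the largest of their rewards has this order, and the optimum is at least that single
reward (`exists_measure_forall_le_le`). The planner misses such rewards, for two reasons.

First, it stays near the diagonal. By translation and reflection invariance, its displacement over
one iteration is symmetric, bounded by `m`, and independent of the past, which lies in lower layers.
Hence its `n / m` iterations have sub-Gaussian drift (`measure_exists_isReachable_le`), and all of
its path lies in a strip of width `s * n` when `n / m` is large. The strip has of order `s * n ^ 2`
vertices, so for small `s` it probably contains no reward above `η * n ^ (2 / α)`
(`exists_measure_strip_le`).

Second, smaller rewards do not add up on any directed path. A path meets at most of order `n * (xm /
t) ^ (α / 2)` rewards above `t`, as the first moment of the number of chains of such vertices shows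
(`exists_card_lt_le`). Summing over dyadic `t ≤ η * n ^ (2 / α)` converges because `α < 2`, and
gives a small multiple of `n ^ (2 / α)` (`exists_truncation_level`).

This yields convergence in probability. For almost sure convergence, the failure probabilities need
not be summable in `n`, so the fields are coupled. The number of accuracy levels that fail at `n`
has mean at most 2. Making a real code of the field, ordered by this number, a quantile of one
uniform variable bounds it in `n` almost surely (`exists_coupling`). The coupling has to serve all
`M`, hence the bad events are united over all divisors of `n` (`exists_uniform_bad_events`). -/

open scoped ENNReal

/-! ### Directed paths, layers and drift -/

/-- The layer of a lattice vertex: the number of steps of each path from the origin to it. -/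
def layer (u : ℕ × ℕ) : ℕ := u.1 + u.2

/-- The signed displacement of a vertex from the diagonal. -/
def drift (u : ℕ × ℕ) : ℝ := (u.1 : ℝ) - u.2

theorem LatticeEdge.layer_eq {u v : ℕ × ℕ} (h : LatticeEdge u v) : layer v = layer u + 1 := by
  rcases h with h | h <;> subst h <;> simp only [layer] <;> omega

theorem LatticeEdge.lt {u v : ℕ × ℕ} (h : LatticeEdge u v) : u < v := by
  rcases h with h | h <;> subst h
  · exact Prod.mk_lt_mk.2 (Or.inl ⟨by omega, le_rfl⟩)
  · exact Prod.mk_lt_mk.2 (Or.inr ⟨le_rfl, by omega⟩)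

theorem LatticeEdge.abs_drift_sub_le {u v : ℕ × ℕ} (h : LatticeEdge u v) :
    |drift v - drift u| ≤ 1 := by
  rcases h with h | h <;> subst h <;> simp [drift]

theorem layer_of_mem_latticePaths {v : ℕ × ℕ} {n : ℕ} {p : Fin (n + 1) → ℕ × ℕ}
    (hp : p ∈ latticePaths v n) (i : Fin (n + 1)) : layer (p i) = layer v + i := by
  induction i using Fin.induction with
  | zero => simp [hp.1]
  | succ i ih =>
    rw [(hp.2 i).layer_eq, ih]
    simp only [Fin.val_castSucc, Fin.val_succ]
    omega

theorem le_of_mem_latticePaths {v : ℕ × ℕ} {n : ℕ} {p : Fin (n + 1) → ℕ × ℕ}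
    (hp : p ∈ latticePaths v n) (i : Fin (n + 1)) : v ≤ p i := by
  induction i using Fin.induction with
  | zero => simp [hp.1]
  | succ i ih => exact ih.trans (hp.2 i).lt.le

theorem pathReward_le_maxReward (r : ℕ × ℕ → ℝ) {v : ℕ × ℕ} {n : ℕ} {p : Fin (n + 1) → ℕ × ℕ}
    (hp : p ∈ latticePaths v n) : pathReward r p ≤ maxReward r v n :=
  (isGreatest_maxReward r v n).2 ⟨p, hp, rfl⟩

/-- An infinite directed path from the origin. -/
structure IsRoute (γ : ℕ → ℕ × ℕ) : Prop where
  zero : γ 0 = (0, 0)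
  step : ∀ i, LatticeEdge (γ i) (γ (i + 1))

namespace IsRoute

variable {γ : ℕ → ℕ × ℕ}

theorem layer_eq (h : IsRoute γ) (i : ℕ) : layer (γ i) = i := by
  induction i with
  | zero => rw [h.zero]; rfl
  | succ i ih => rw [(h.step i).layer_eq, ih]

theorem abs_drift_sub_le (h : IsRoute γ) (i j : ℕ) :
    |drift (γ (i + j)) - drift (γ i)| ≤ j := by
  induction j with
  | zero => simp
  | succ j ih =>
    have h1 := (h.step (i + j)).abs_drift_sub_le
    rw [← add_assoc]
    push_cast
    calc |drift (γ (i + j + 1)) - drift (γ i)|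
        = |(drift (γ (i + j + 1)) - drift (γ (i + j))) + (drift (γ (i + j)) - drift (γ i))| := by
          ring_nf
      _ ≤ _ := (abs_add_le _ _).trans (by linarith)

end IsRoute

theorem sum_le_maxReward_of_isRoute (r : ℕ × ℕ → ℝ) {γ : ℕ → ℕ × ℕ} (h : IsRoute γ) (n : ℕ) :
    ∑ i ∈ Finset.range n, r (γ (i + 1)) ≤ maxReward r (0, 0) n := by
  have hp : (fun i : Fin (n + 1) => γ i) ∈ latticePaths (0, 0) n :=
    ⟨by simpa using h.zero, fun i => by simpa using h.step i⟩
  refine le_trans (le_of_eq ?_) (pathReward_le_maxReward r hp)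
  simp [pathReward, Finset.sum_range]

theorem exists_isRoute_apply_layer (u : ℕ × ℕ) : ∃ γ, IsRoute γ ∧ γ (layer u) = u := by
  refine ⟨fun i => if i ≤ u.1 then (i, 0) else (u.1, i - u.1), ⟨by simp, fun i => ?_⟩, ?_⟩
  · rcases lt_trichotomy i u.1 with hi | hi | hi
    · left; simp [hi.le, Nat.succ_le_of_lt hi]
    · right; simp [hi]
    · right
      simp only [not_le.2 hi, not_le.2 (hi.trans (Nat.lt_succ_self i)), if_false]
      rw [Nat.succ_sub hi.le]
  · obtain ⟨a, b⟩ := u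
    rcases Nat.eq_zero_or_pos b with rfl | hb
    · simp [layer]
    · simp [layer, hb.ne']

/-- The only lower bound on the optimum that is needed: one large reward can always be fetched. -/
theorem le_maxReward_of_nonneg {r : ℕ × ℕ → ℝ} (hr : ∀ u, 0 ≤ r u) {u : ℕ × ℕ} {n : ℕ}
    (h1 : 1 ≤ layer u) (h2 : layer u ≤ n) : r u ≤ maxReward r (0, 0) n := by
  obtain ⟨γ, hγ, hu⟩ := exists_isRoute_apply_layer u
  refine le_trans ?_ (sum_le_maxReward_of_isRoute r hγ n)
  have h3 : layer u - 1 ∈ Finset.range n := by simp; omega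
  refine le_trans (le_of_eq ?_)
    (Finset.single_le_sum (f := fun i => r (γ (i + 1))) (fun i _ => hr _) h3)
  rw [Nat.sub_add_cancel h1, hu]

theorem maxReward_nonneg {r : ℕ × ℕ → ℝ} (hr : ∀ u, 0 ≤ r u) (v : ℕ × ℕ) (n : ℕ) :
    0 ≤ maxReward r v n := by
  obtain ⟨p, hp⟩ := latticePaths_nonempty v n
  exact le_trans (Finset.sum_nonneg fun i _ => hr _) (pathReward_le_maxReward r hp)

/-- The paths followed in the iterations of a planner run form one infinite directed path. -/
theorem IsPlannerRun.exists_isRoute {r : ℕ × ℕ → ℝ} {m : ℕ} {v : ℕ → ℕ × ℕ} (hm : 1 ≤ m)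
    (h : IsPlannerRun r m v) : ∃ γ, IsRoute γ ∧ (∀ k, γ (k * m) = v k) ∧
      ∀ K, ∑ k ∈ Finset.range K, maxReward r (v k) m =
        ∑ i ∈ Finset.range (K * m), r (γ (i + 1)) := by
  obtain ⟨h0, h⟩ := h
  choose p hp hr hl using h
  have hlt : ∀ i, i % m < m + 1 := fun i => (Nat.mod_lt i hm).trans (Nat.lt_succ_self m)
  let γ : ℕ → ℕ × ℕ := fun i => p (i / m) ⟨i % m, hlt i⟩
  -- The case `j = m` is included: there the definition of `γ` already reads from leg `k + 1`, which
  -- starts where leg `k` ends.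
  have hγ : ∀ k j (hj : j < m + 1), γ (k * m + j) = p k ⟨j, hj⟩ := by
    intro k j hj
    rcases (Nat.lt_succ_iff.1 hj).lt_or_eq with hj' | rfl
    · have e1 : (k * m + j) / m = k := by
        rw [mul_comm, Nat.mul_add_div hm, Nat.div_eq_of_lt hj', add_zero]
      have e2 : (k * m + j) % m = j := by
        rw [mul_comm, Nat.mul_add_mod, Nat.mod_eq_of_lt hj']
      simp only [γ, e1, e2]
    · have e1 : (k * j + j) / j = k + 1 := by
        rw [← Nat.succ_mul, Nat.mul_div_cancel _ hm]
      have e2 : (k * j + j) % j = 0 := by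
        rw [← Nat.succ_mul, Nat.mul_mod_left]
      simp only [γ, e1, e2]
      exact (hp (k + 1)).1.trans (hl k).symm
  have hv : ∀ k, γ (k * m) = v k := fun k => (hγ k 0 (by omega)).trans (hp k).1
  refine ⟨γ, ⟨?_, fun i => ?_⟩, hv, fun K => ?_⟩
  · rw [← h0, ← hv 0, zero_mul]
  · have hi : i = i / m * m + i % m := by rw [mul_comm]; exact (Nat.div_add_mod i m).symm
    have hj := Nat.mod_lt i hm
    have e1 : γ (i + 1) = p (i / m) ⟨i % m + 1, by omega⟩ := by
      rw [← hγ, ← add_assoc, ← hi]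
    rw [e1]
    exact (hp (i / m)).2 ⟨i % m, hj⟩
  · induction K with
    | zero => simp
    | succ K ih =>
      rw [Finset.sum_range_succ, ih, Nat.succ_mul, Finset.sum_range_add, ← hr K, pathReward,
        Finset.sum_range]
      congr 1
      rw [Finset.sum_range]
      refine Finset.sum_congr rfl fun i _ => ?_
      rw [add_assoc, hγ K (i + 1) (by omega)]
      rfl

/-! ### Tails of the Pareto law -/

section Pareto

variable {xm α t : ℝ}

theorem paretoMeasure_Ioi (hxm : 0 < xm) (hα : 0 < α) (ht : xm ≤ t) :
    paretoMeasure xm α (Set.Ioi t) = ENNReal.ofReal ((xm / t) ^ α) := by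
  have ht0 : 0 < t := hxm.trans_le ht
  rw [paretoMeasure, withDensity_apply _ measurableSet_Ioi,
    setLIntegral_congr_fun (g := fun x => ENNReal.ofReal (α * xm ^ α * x ^ (-(α + 1))))
      measurableSet_Ioi (fun x hx => paretoPDF_of_le (ht.trans (le_of_lt hx))),
    ← ofReal_integral_eq_lintegral_ofReal]
  · rw [integral_const_mul, integral_Ioi_rpow_of_lt (by linarith) ht0]
    congr 1
    rw [Real.div_rpow hxm.le ht0.le, show -(α + 1) + 1 = -α by ring, Real.rpow_neg ht0.le]
    field_simp
  · exact (integrableOn_Ioi_rpow_of_lt (by linarith) ht0).const_mul _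
  · refine (ae_restrict_iff' measurableSet_Ioi).2 (ae_of_all _ fun x hx => ?_)
    have : 0 < x := ht0.trans hx
    simp only [Pi.zero_apply]
    positivity

theorem paretoMeasure_Ioi_le (hxm : 0 < xm) (hα : 0 < α) (ht : 0 < t) :
    paretoMeasure xm α (Set.Ioi t) ≤ ENNReal.ofReal ((xm / t) ^ α) := by
  rcases le_or_gt xm t with h | h
  · exact (paretoMeasure_Ioi hxm hα h).le
  · have := isProbabilityMeasure_paretoMeasure hxm hα
    refine prob_le_one.trans (ENNReal.one_le_ofReal.2 ?_)
    exact Real.one_le_rpow ((one_le_div ht).2 h.le) hα.le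

theorem paretoMeasure_Iio_scale : paretoMeasure xm α (Set.Iio xm) = 0 := by
  rw [paretoMeasure, withDensity_apply _ measurableSet_Iio, lintegral_paretoPDF_of_le le_rfl]

instance nullSingletonClass_paretoMeasure : NullSingletonClass (paretoMeasure xm α) := by
  unfold paretoMeasure; infer_instance

theorem paretoMeasure_Iic_le (hxm : 0 < xm) (hα : 0 < α) (ht : 0 < t) :
    paretoMeasure xm α (Set.Iic t) ≤ ENNReal.ofReal (Real.exp (-(xm / t) ^ α)) := by
  have := isProbabilityMeasure_paretoMeasure hxm hα
  rcases le_or_gt xm t with h | h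
  · rw [← Set.compl_Ioi, prob_compl_eq_one_sub measurableSet_Ioi, paretoMeasure_Ioi hxm hα h,
      ← ENNReal.ofReal_one, ← ENNReal.ofReal_sub _ (by positivity)]
    refine ENNReal.ofReal_le_ofReal ?_
    have := Real.add_one_le_exp (-(xm / t) ^ α)
    linarith
  · refine (le_trans (measure_mono (Set.Iic_subset_Iio.2 h)) paretoMeasure_Iio_scale.le).trans ?_
    exact zero_le

end Pareto

/-! ### Independence and law of the reward field -/

/-- The σ-algebra generated by the rewards at the vertices in `S`. -/
abbrev rewardSigma {Ω : Type*} (r : Ω → ℕ × ℕ → ℝ) (S : Set (ℕ × ℕ)) : MeasurableSpace Ω :=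
  ⨆ u ∈ S, MeasurableSpace.comap (fun ω => r ω u) inferInstance

theorem measurable_rewardSigma {Ω : Type*} (r : Ω → ℕ × ℕ → ℝ) {S : Set (ℕ × ℕ)} {u : ℕ × ℕ}
    (hu : u ∈ S) : Measurable[rewardSigma r S] fun ω => r ω u :=
  measurable_iff_comap_le.2 (le_iSup₂_of_le u hu le_rfl)

namespace IsParetoField

variable {Ω : Type*} [MeasurableSpace Ω] {P : Measure Ω} {xm α : ℝ} {r : Ω → ℕ × ℕ → ℝ}

theorem rewardSigma_le (h : IsParetoField P xm α r) (S : Set (ℕ × ℕ)) :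
    rewardSigma r S ≤ ‹MeasurableSpace Ω› :=
  iSup₂_le fun u _ => (h.measurable u).comap_le

theorem indep_rewardSigma (h : IsParetoField P xm α r) {S T : Set (ℕ × ℕ)} (hST : Disjoint S T) :
    Indep (rewardSigma r S) (rewardSigma r T) P :=
  indep_iSup_of_disjoint (fun u => (h.measurable u).comap_le) h.indep hST

theorem measure_preimage (h : IsParetoField P xm α r) (u : ℕ × ℕ) {A : Set ℝ}
    (hA : MeasurableSet A) : P {ω | r ω u ∈ A} = paretoMeasure xm α A := by
  rw [← h.law u, Measure.map_apply (h.measurable u) hA]; rfl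

theorem isProbabilityMeasure (h : IsParetoField P xm α r) (hxm : 0 < xm) (hα : 0 < α) :
    IsProbabilityMeasure P := by
  have := isProbabilityMeasure_paretoMeasure hxm hα
  have h1 := h.measure_preimage (0, 0) MeasurableSet.univ
  exact ⟨by simpa using h1⟩

theorem ae_pos (h : IsParetoField P xm α r) (hxm : 0 < xm) : ∀ᵐ ω ∂P, ∀ u, 0 < r ω u := by
  refine ae_all_iff.2 fun u => ?_
  have h1 : ∀ᵐ ω ∂P, r ω u ∉ Set.Iio xm := by
    rw [ae_iff]
    simp only [not_not]
    rw [h.measure_preimage u measurableSet_Iio, paretoMeasure_Iio_scale]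
  filter_upwards [h1] with ω hω
  exact hxm.trans_le (not_lt.1 hω)

theorem map_eq (h : IsParetoField P xm α r) (hxm : 0 < xm) (hα : 0 < α) :
    P.map r = Measure.infinitePi fun _ : ℕ × ℕ => paretoMeasure xm α := by
  have := h.isProbabilityMeasure hxm hα
  have h1 := (iIndepFun_iff_map_fun_eq_infinitePi_map h.measurable).1 h.indep
  simp only [h.law] at h1
  exact h1

theorem precomp (h : IsParetoField P xm α r) {f : ℕ × ℕ → ℕ × ℕ} (hf : Function.Injective f) :
    IsParetoField P xm α fun ω => r ω ∘ f :=
  ⟨fun v => h.measurable (f v), h.indep.precomp hf, fun v => h.law (f v)⟩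

theorem measurable_pi (h : IsParetoField P xm α r) : Measurable r :=
  measurable_pi_iff.2 h.measurable

end IsParetoField

theorem isParetoField_id {xm α : ℝ} (hxm : 0 < xm) (hα : 0 < α) :
    IsParetoField (Measure.infinitePi fun _ : ℕ × ℕ => paretoMeasure xm α) xm α id := by
  have := isProbabilityMeasure_paretoMeasure hxm hα
  have h1 : ∀ u : ℕ × ℕ, (Measure.infinitePi fun _ : ℕ × ℕ => paretoMeasure xm α).map
      (fun ω => ω u) = paretoMeasure xm α := fun u =>
    (measurePreserving_eval_infinitePi (fun _ : ℕ × ℕ => paretoMeasure xm α) u).map_eq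
  refine ⟨fun v => measurable_pi_apply v, ?_, h1⟩
  refine (iIndepFun_iff_map_fun_eq_infinitePi_map (fun v => measurable_pi_apply v)).2 ?_
  simp only [h1]
  exact Measure.map_id

/-- Being a Pareto field is a property of the law alone, so a coupling only has to preserve the law.
-/
theorem IsParetoField.of_map_eq {Ω : Type*} [MeasurableSpace Ω] {P : Measure Ω}
    [IsProbabilityMeasure P] {xm α : ℝ} {r : Ω → ℕ × ℕ → ℝ} (hxm : 0 < xm) (hα : 0 < α)
    (hr : Measurable r)
    (h : P.map r = Measure.infinitePi fun _ : ℕ × ℕ => paretoMeasure xm α) :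
    IsParetoField P xm α r := by
  have hm : ∀ v, Measurable fun ω => r ω v := fun v => measurable_pi_iff.1 hr v
  have h1 : ∀ v, P.map (fun ω => r ω v) = paretoMeasure xm α := fun v => by
    have h2 := (isParetoField_id hxm hα).law v
    rw [← h] at h2
    rw [← h2]
    exact (Measure.map_map (measurable_pi_apply v) hr).symm
  refine ⟨hm, ?_, h1⟩
  rw [iIndepFun_iff_map_fun_eq_infinitePi_map hm]
  simp only [h1]
  exact h

/-! ### End vertices of optimal paths: symmetries and measurability -/

/-- `w` is the last vertex of a maximum-reward path with `m` steps from `v`. -/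
def IsBestEnd (r : ℕ × ℕ → ℝ) (m : ℕ) (v w : ℕ × ℕ) : Prop :=
  ∃ p ∈ latticePaths v m, pathReward r p = maxReward r v m ∧ p (Fin.last m) = w

/-- `w` can be the start of the `k`-th iteration of the planner. -/
def IsReachable (r : ℕ × ℕ → ℝ) (m : ℕ) : ℕ → ℕ × ℕ → Prop
  | 0, w => w = (0, 0)
  | k + 1, w => ∃ v, IsReachable r m k v ∧ IsBestEnd r m v w

theorem IsPlannerRun.isReachable {r : ℕ × ℕ → ℝ} {m : ℕ} {v : ℕ → ℕ × ℕ}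
    (h : IsPlannerRun r m v) (k : ℕ) : IsReachable r m k (v k) := by
  induction k with
  | zero => exact h.1
  | succ k ih => exact ⟨v k, ih, h.2 k⟩

theorem IsBestEnd.layer_eq {r : ℕ × ℕ → ℝ} {m : ℕ} {v w : ℕ × ℕ} (h : IsBestEnd r m v w) :
    layer w = layer v + m := by
  obtain ⟨p, hp, -, rfl⟩ := h
  rw [layer_of_mem_latticePaths hp, Fin.val_last]

theorem IsBestEnd.le {r : ℕ × ℕ → ℝ} {m : ℕ} {v w : ℕ × ℕ} (h : IsBestEnd r m v w) : v ≤ w := by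
  obtain ⟨p, hp, -, rfl⟩ := h
  exact le_of_mem_latticePaths hp _

theorem IsReachable.layer_eq {r : ℕ × ℕ → ℝ} {m k : ℕ} {w : ℕ × ℕ} (h : IsReachable r m k w) :
    layer w = k * m := by
  induction k generalizing w with
  | zero => obtain rfl := h; simp [layer]
  | succ k ih =>
    obtain ⟨v, hv, hvw⟩ := h
    rw [hvw.layer_eq, ih hv, Nat.succ_mul]

theorem abs_drift_le_layer (u : ℕ × ℕ) : |drift u| ≤ layer u := by
  have h1 : (0 : ℝ) ≤ u.1 := Nat.cast_nonneg _
  have h2 : (0 : ℝ) ≤ u.2 := Nat.cast_nonneg _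
  rw [drift, layer, abs_le]
  push_cast
  constructor <;> linarith

theorem drift_add (u v : ℕ × ℕ) : drift (u + v) = drift u + drift v := by
  simp only [drift, Prod.fst_add, Prod.snd_add]
  push_cast
  ring

theorem drift_swap (u : ℕ × ℕ) : drift u.swap = -drift u := by
  simp only [drift, Prod.fst_swap, Prod.snd_swap]
  ring

theorem latticeEdge_add_left (c u v : ℕ × ℕ) : LatticeEdge (c + u) (c + v) ↔ LatticeEdge u v := by
  simp only [LatticeEdge, Prod.ext_iff, Prod.fst_add, Prod.snd_add]
  constructor <;> rintro (h | h) <;> [left; right; left; right] <;> omega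

theorem latticeEdge_swap (u v : ℕ × ℕ) : LatticeEdge u.swap v.swap ↔ LatticeEdge u v := by
  simp only [LatticeEdge, Prod.ext_iff, Prod.fst_swap, Prod.snd_swap]
  constructor <;> rintro (h | h) <;> [right; left; right; left] <;> omega

theorem add_comp_mem_latticePaths {c v : ℕ × ℕ} {m : ℕ} {p : Fin (m + 1) → ℕ × ℕ}
    (hp : p ∈ latticePaths v m) : (fun i => c + p i) ∈ latticePaths (c + v) m :=
  ⟨by simp [hp.1], fun i => (latticeEdge_add_left _ _ _).2 (hp.2 i)⟩

theorem exists_add_of_mem_latticePaths {c : ℕ × ℕ} {m : ℕ} {p : Fin (m + 1) → ℕ × ℕ}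
    (hp : p ∈ latticePaths c m) : ∃ q ∈ latticePaths (0, 0) m, p = fun i => c + q i := by
  have h1 : ∀ i, c + (p i - c) = p i := fun i => add_tsub_cancel_of_le (le_of_mem_latticePaths hp i)
  refine ⟨fun i => p i - c, ⟨by simp [hp.1]; rfl, fun i => ?_⟩, funext fun i => (h1 i).symm⟩
  rw [← latticeEdge_add_left c, h1, h1]
  exact hp.2 i

theorem isBestEnd_iff {r : ℕ × ℕ → ℝ} {m : ℕ} {v w : ℕ × ℕ} :
    IsBestEnd r m v w ↔ ∃ p ∈ latticePaths v m, p (Fin.last m) = w ∧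
      ∀ q ∈ latticePaths v m, pathReward r q ≤ pathReward r p := by
  refine exists_congr fun p => and_congr_right fun hp => ?_
  rw [and_comm]
  refine and_congr_right fun _ => ⟨fun h q hq => h ▸ pathReward_le_maxReward r hq, fun h => ?_⟩
  refine le_antisymm (pathReward_le_maxReward r hp) ?_
  obtain ⟨q, hq, hqr⟩ := (isGreatest_maxReward r v m).1
  exact hqr ▸ h q hq

theorem isBestEnd_add_iff (r : ℕ × ℕ → ℝ) (m : ℕ) (c z : ℕ × ℕ) :
    IsBestEnd r m c (c + z) ↔ IsBestEnd (r ∘ (c + ·)) m (0, 0) z := by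
  rw [isBestEnd_iff, isBestEnd_iff]
  constructor
  · rintro ⟨p, hp, hl, hmax⟩
    obtain ⟨p, hp', rfl⟩ := exists_add_of_mem_latticePaths hp
    refine ⟨p, hp', by simpa using hl, fun q hq => ?_⟩
    exact hmax _ (add_comp_mem_latticePaths (c := c) hq)
  · rintro ⟨p, hp, hl, hmax⟩
    refine ⟨fun i => c + p i, add_comp_mem_latticePaths (c := c) hp, by simp [hl], fun q hq => ?_⟩
    obtain ⟨q, hq', rfl⟩ := exists_add_of_mem_latticePaths hq
    exact hmax _ hq'

/-- Reflection in the diagonal permutes the paths from the origin. One implication suffices, as the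
reflection is an involution. -/
theorem isBestEnd_swap {r : ℕ × ℕ → ℝ} {m : ℕ} {z : ℕ × ℕ}
    (h : IsBestEnd r m (0, 0) z.swap) : IsBestEnd (r ∘ Prod.swap) m (0, 0) z := by
  have hs : ∀ {p : Fin (m + 1) → ℕ × ℕ}, p ∈ latticePaths (0, 0) m →
      (fun i => (p i).swap) ∈ latticePaths (0, 0) m := fun {p} hp =>
    ⟨by simp [hp.1], fun i => (latticeEdge_swap _ _).2 (hp.2 i)⟩
  rw [isBestEnd_iff] at h ⊢
  obtain ⟨p, hp, hl, hmax⟩ := h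
  refine ⟨fun i => (p i).swap, hs hp, by simp [hl], fun q hq => ?_⟩
  refine (hmax _ (hs hq)).trans (le_of_eq ?_)
  simp [pathReward]

theorem measurable_pathReward {Ω : Type*} [MeasurableSpace Ω] {r : Ω → ℕ × ℕ → ℝ} {n : ℕ}
    {p : Fin (n + 1) → ℕ × ℕ} (h : ∀ i : Fin n, Measurable fun ω => r ω (p i.succ)) :
    Measurable fun ω => pathReward (r ω) p :=
  Finset.measurable_sum _ fun i _ => h i

/-- Measurability is required only on the layers after that of `v`, so that the lemma applies to the
σ-algebra of the rewards not yet used by the planner. -/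
theorem measurableSet_isBestEnd {Ω : Type*} [MeasurableSpace Ω] {r : Ω → ℕ × ℕ → ℝ} {m : ℕ}
    {v : ℕ × ℕ} (w : ℕ × ℕ)
    (h : ∀ u, layer v < layer u → layer u ≤ layer v + m → Measurable fun ω => r ω u) :
    MeasurableSet {ω | IsBestEnd (r ω) m v w} := by
  have hm : ∀ p ∈ latticePaths v m, Measurable fun ω => pathReward (r ω) p := fun p hp =>
    measurable_pathReward fun i => h _
      (by rw [layer_of_mem_latticePaths hp, Fin.val_succ]; omega)
      (by rw [layer_of_mem_latticePaths hp, Fin.val_succ]; omega)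
  have h1 : {ω | IsBestEnd (r ω) m v w} = ⋃ p ∈ {p ∈ latticePaths v m | p (Fin.last m) = w},
      ⋂ q ∈ latticePaths v m, {ω | pathReward (r ω) q ≤ pathReward (r ω) p} := by
    ext ω
    simp only [Set.mem_ofPred_eq, isBestEnd_iff, Set.mem_iUnion, Set.mem_iInter, exists_prop,
      and_assoc]
  rw [h1]
  have hf := latticePaths_finite v m
  exact MeasurableSet.biUnion (hf.subset (Set.sep_subset _ _)).countable fun p hp =>
    MeasurableSet.biInter hf.countable fun q hq => measurableSet_le (hm q hq) (hm p hp.1)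

theorem measurableSet_isReachable {Ω : Type*} [MeasurableSpace Ω] {r : Ω → ℕ × ℕ → ℝ} {m k : ℕ}
    (w : ℕ × ℕ) (h : ∀ u, layer u ≤ k * m → Measurable fun ω => r ω u) :
    MeasurableSet {ω | IsReachable (r ω) m k w} := by
  induction k generalizing w with
  | zero => exact MeasurableSet.const _
  | succ k ih =>
    have h1 : {ω | IsReachable (r ω) m (k + 1) w} = ⋃ v ∈ {v | layer v = k * m},
        {ω | IsReachable (r ω) m k v} ∩ {ω | IsBestEnd (r ω) m v w} := by
      ext ω
      simp only [IsReachable, Set.mem_ofPred_eq, Set.mem_iUnion, exists_prop, Set.mem_inter_iff]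
      exact ⟨fun ⟨v, hv, hvw⟩ => ⟨v, hv.layer_eq, hv, hvw⟩, fun ⟨v, _, hv, hvw⟩ => ⟨v, hv, hvw⟩⟩
    rw [h1]
    refine MeasurableSet.biUnion (Set.to_countable _) fun v hv => ?_
    have hv' : layer v = k * m := hv
    have hk : (k + 1) * m = k * m + m := Nat.succ_mul k m
    exact (ih v fun u hu => h u (by omega)).inter
      (measurableSet_isBestEnd w fun u _ hu => h u (by omega))

/-! ### Ties have probability zero -/

/-- Two independent random variables one of which has no atoms are almost surely different. -/
theorem measure_eq_zero_of_indepFun {Ω : Type*} [MeasurableSpace Ω] {P : Measure Ω}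
    [IsProbabilityMeasure P] {X Y : Ω → ℝ} (hX : Measurable X) (hY : Measurable Y)
    (h : IndepFun X Y P) [NullSingletonClass (P.map X)] : P {ω | X ω = Y ω} = 0 := by
  have hd : MeasurableSet {z : ℝ × ℝ | z.1 = z.2} :=
    measurableSet_eq_fun measurable_fst measurable_snd
  have h1 : P {ω | X ω = Y ω} = P.map (fun ω => (X ω, Y ω)) {z : ℝ × ℝ | z.1 = z.2} := by
    rw [Measure.map_apply (hX.prodMk hY) hd]; rfl
  have := Measure.isProbabilityMeasure_map (μ := P) hX.aemeasurable
  have := Measure.isProbabilityMeasure_map (μ := P) hY.aemeasurable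
  rw [h1, (indepFun_iff_map_prod_eq_prod_map_map hX.aemeasurable hY.aemeasurable).1 h,
    Measure.prod_apply_symm hd]
  refine (lintegral_congr fun y => ?_).trans lintegral_zero
  have h2 : (fun x => (x, y)) ⁻¹' {z : ℝ × ℝ | z.1 = z.2} = {y} := by ext; simp
  rw [h2, measure_singleton]

namespace IsParetoField

variable {Ω : Type*} [MeasurableSpace Ω] {P : Measure Ω} {xm α : ℝ} {r : Ω → ℕ × ℕ → ℝ}

/-- The two end vertices are distinct and in the same layer, so the end `z` of `p` is visited
neither by `q` nor earlier by `p`. A tie thus forces the atomless reward at `z` to equal a variable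
`Y` independent of it. -/
theorem measure_pathReward_eq (h : IsParetoField P xm α r) (hxm : 0 < xm) (hα : 0 < α)
    {v : ℕ × ℕ} {m : ℕ} {p q : Fin (m + 1) → ℕ × ℕ} (hp : p ∈ latticePaths v m)
    (hq : q ∈ latticePaths v m) (hpq : p (Fin.last m) ≠ q (Fin.last m)) :
    P {ω | pathReward (r ω) p = pathReward (r ω) q} = 0 := by
  have := h.isProbabilityMeasure hxm hα
  cases m with
  | zero => exact absurd (hp.1.trans hq.1.symm) hpq
  | succ m =>
    set z := p (Fin.last (m + 1)) with hz
    set Y : Ω → ℝ := fun ω => pathReward (r ω) q - ∑ i : Fin m, r ω (p i.castSucc.succ) with hY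
    have h1 : {ω | pathReward (r ω) p = pathReward (r ω) q} = {ω | r ω z = Y ω} := by
      ext ω
      simp only [Set.mem_ofPred_eq, hY, hz]
      rw [pathReward, Fin.sum_univ_castSucc, Fin.succ_last]
      constructor <;> intro h <;> linarith
    have hq' : ∀ i : Fin (m + 1), q i.succ ∈ ({z}ᶜ : Set (ℕ × ℕ)) := by
      intro i hi
      have hi' : q i.succ = z := hi
      have e1 := layer_of_mem_latticePaths hq i.succ
      rw [hi', hz, layer_of_mem_latticePaths hp] at e1
      have e2 : i.succ = Fin.last (m + 1) := by ext; simp at e1 ⊢; omega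
      rw [e2] at hi'
      exact hpq hi'.symm
    have hp' : ∀ i : Fin m, p i.castSucc.succ ∈ ({z}ᶜ : Set (ℕ × ℕ)) := by
      intro i hi
      have hi' : p i.castSucc.succ = z := hi
      have e1 := layer_of_mem_latticePaths hp i.castSucc.succ
      rw [hi', hz, layer_of_mem_latticePaths hp] at e1
      simp at e1
      omega
    have hYm : Measurable[rewardSigma r {z}ᶜ] Y := by
      refine Measurable.sub (m := rewardSigma r {z}ᶜ) ?_ ?_
      · exact @measurable_pathReward _ (rewardSigma r {z}ᶜ) _ _ _
          fun i => measurable_rewardSigma r (hq' i)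
      · exact @Finset.measurable_sum _ _ _ _ _ _ (rewardSigma r {z}ᶜ) _ _
          fun i _ => measurable_rewardSigma r (hp' i)
    have hind : IndepFun (fun ω => r ω z) Y P :=
      indep_of_indep_of_le_right (indep_of_indep_of_le_left
        (h.indep_rewardSigma (S := {z}) (T := {z}ᶜ) disjoint_compl_right)
        (measurable_rewardSigma r (Set.mem_singleton z)).comap_le) hYm.comap_le
    rw [h1]
    have : NullSingletonClass (P.map fun ω => r ω z) := by rw [h.law]; infer_instance
    exact measure_eq_zero_of_indepFun (h.measurable z) (hYm.mono (h.rewardSigma_le _) le_rfl) hind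

theorem measure_isBestEnd_inter (h : IsParetoField P xm α r) (hxm : 0 < xm) (hα : 0 < α)
    (m : ℕ) {v w w' : ℕ × ℕ} (hw : w ≠ w') :
    P ({ω | IsBestEnd (r ω) m v w} ∩ {ω | IsBestEnd (r ω) m v w'}) = 0 := by
  have hf := latticePaths_finite v m
  refine measure_mono_null (t := ⋃ p ∈ latticePaths v m, ⋃ q ∈ latticePaths v m,
    {ω | p (Fin.last m) ≠ q (Fin.last m) ∧ pathReward (r ω) p = pathReward (r ω) q}) ?_ ?_
  · rintro ω ⟨⟨p, hp, hpr, hpl⟩, q, hq, hqr, hql⟩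
    simp only [Set.mem_iUnion, exists_prop]
    exact ⟨p, hp, q, hq, by rw [hpl, hql]; exact hw, hpr.trans hqr.symm⟩
  · refine (measure_biUnion_null_iff hf.countable).2 fun p hp => ?_
    refine (measure_biUnion_null_iff hf.countable).2 fun q hq => ?_
    by_cases hpq : p (Fin.last m) = q (Fin.last m)
    · simp [hpq]
    · exact measure_mono_null (fun ω hω => hω.2) (h.measure_pathReward_eq hxm hα hp hq hpq)

/-- The events are disjoint up to null sets. This makes the arbitrary tie-breaking harmless: no
measurable choice of a run is ever needed. -/
theorem tsum_measure_isBestEnd_le_one (h : IsParetoField P xm α r) (hxm : 0 < xm) (hα : 0 < α)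
    (m : ℕ) (v : ℕ × ℕ) : ∑' w, P {ω | IsBestEnd (r ω) m v w} ≤ 1 := by
  have := h.isProbabilityMeasure hxm hα
  rw [← measure_iUnion₀]
  · exact prob_le_one
  · exact fun w w' hw => h.measure_isBestEnd_inter hxm hα m hw
  · exact fun w => (measurableSet_isBestEnd w fun u _ _ => h.measurable u).nullMeasurableSet

end IsParetoField

/-! ### Sub-Gaussian drift of the planner -/

namespace IsParetoField

variable {Ω : Type*} [MeasurableSpace Ω] {P : Measure Ω} {xm α : ℝ} {r : Ω → ℕ × ℕ → ℝ}

theorem measurableSet_isBestEnd (h : IsParetoField P xm α r) (m : ℕ) (v w : ℕ × ℕ) :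
    MeasurableSet {ω | IsBestEnd (r ω) m v w} :=
  _root_.measurableSet_isBestEnd w fun u _ _ => h.measurable u

theorem measure_isBestEnd_comp (h : IsParetoField P xm α r) (hxm : 0 < xm) (hα : 0 < α)
    {f : ℕ × ℕ → ℕ × ℕ} (hf : Function.Injective f) (m : ℕ) (v w : ℕ × ℕ) :
    P {ω | IsBestEnd (r ω ∘ f) m v w} = P {ω | IsBestEnd (r ω) m v w} := by
  have hA : MeasurableSet {s : ℕ × ℕ → ℝ | IsBestEnd s m v w} :=
    (isParetoField_id hxm hα).measurableSet_isBestEnd m v w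
  have h1 : ∀ r' : Ω → ℕ × ℕ → ℝ, IsParetoField P xm α r' → P {ω | IsBestEnd (r' ω) m v w} =
      (Measure.infinitePi fun _ : ℕ × ℕ => paretoMeasure xm α) {s | IsBestEnd s m v w} := by
    intro r' h'
    rw [← h'.map_eq hxm hα, Measure.map_apply h'.measurable_pi hA]
    rfl
  rw [h1 _ h, h1 _ (h.precomp hf)]

theorem measure_isBestEnd_swap (h : IsParetoField P xm α r) (hxm : 0 < xm) (hα : 0 < α)
    (m : ℕ) (z : ℕ × ℕ) :
    P {ω | IsBestEnd (r ω) m (0, 0) z.swap} = P {ω | IsBestEnd (r ω) m (0, 0) z} := by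
  have h1 : ∀ z : ℕ × ℕ,
      P {ω | IsBestEnd (r ω) m (0, 0) z.swap} ≤ P {ω | IsBestEnd (r ω) m (0, 0) z} := fun z =>
    (measure_mono fun ω hω => isBestEnd_swap hω).trans
      (h.measure_isBestEnd_comp hxm hα Prod.swap_injective m (0, 0) z).le
  refine le_antisymm (h1 z) ?_
  simpa using h1 z.swap

/-- By reflection symmetry the exponential may be replaced by `cosh`, which is at most `exp (x ^ 2 /
2)`, and the drift of one iteration is at most `m`. -/
theorem tsum_measure_isBestEnd_mul_exp_le (h : IsParetoField P xm α r) (hxm : 0 < xm)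
    (hα : 0 < α) (m : ℕ) (l : ℝ) :
    ∑' z, P {ω | IsBestEnd (r ω) m (0, 0) z} * ENNReal.ofReal (Real.exp (l * drift z)) ≤
      ENNReal.ofReal (Real.exp (l ^ 2 * m ^ 2 / 2)) := by
  set β : ℕ × ℕ → ENNReal := fun z => P {ω | IsBestEnd (r ω) m (0, 0) z} with hβ
  set C := ENNReal.ofReal (Real.exp (l ^ 2 * m ^ 2 / 2))
  set S := ∑' z, β z * ENNReal.ofReal (Real.exp (l * drift z)) with hS
  have h1 : S = ∑' z, β z * ENNReal.ofReal (Real.exp (-(l * drift z))) := by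
    rw [hS, ← (Equiv.prodComm ℕ ℕ).tsum_eq]
    refine tsum_congr fun z => ?_
    rw [Equiv.prodComm_apply, drift_swap, mul_neg]
    simp only [hβ, h.measure_isBestEnd_swap hxm hα]
  have h2 : ∀ z, β z * (ENNReal.ofReal (Real.exp (l * drift z)) +
      ENNReal.ofReal (Real.exp (-(l * drift z)))) ≤ β z * (2 * C) := by
    intro z
    by_cases hz : layer z = m
    · gcongr
      rw [← ENNReal.ofReal_add (by positivity) (by positivity),
        ← ENNReal.ofReal_ofNat 2, ← ENNReal.ofReal_mul (by positivity)]
      refine ENNReal.ofReal_le_ofReal ?_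
      have h3 : Real.exp (l * drift z) + Real.exp (-(l * drift z)) =
          2 * Real.cosh (l * drift z) := by rw [Real.cosh_eq]; ring
      rw [h3]
      gcongr
      refine (Real.cosh_le_exp_half_sq _).trans (Real.exp_le_exp.2 ?_)
      have h4 : drift z ^ 2 ≤ (m : ℝ) ^ 2 := by
        rw [← sq_abs]; exact pow_le_pow_left₀ (abs_nonneg _) (hz ▸ abs_drift_le_layer z) 2
      have := mul_le_mul_of_nonneg_left h4 (sq_nonneg l)
      rw [mul_pow]
      linarith
    · have h3 : β z = 0 := by
        refine measure_mono_null (t := ∅) (fun ω hω => hz ?_) measure_empty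
        simpa [layer] using (IsBestEnd.layer_eq hω)
      simp [h3]
  have h3 : 2 * S ≤ 2 * C := by
    calc 2 * S = ∑' z, β z * (ENNReal.ofReal (Real.exp (l * drift z)) +
          ENNReal.ofReal (Real.exp (-(l * drift z)))) := by
            simp only [mul_add]
            rw [ENNReal.tsum_add, ← h1, two_mul]
      _ ≤ ∑' z, β z * (2 * C) := ENNReal.tsum_le_tsum h2
      _ = (∑' z, β z) * (2 * C) := ENNReal.tsum_mul_right
      _ ≤ 1 * (2 * C) := by gcongr; exact h.tsum_measure_isBestEnd_le_one hxm hα m (0, 0)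
      _ = 2 * C := one_mul _
  exact (ENNReal.mul_le_mul_iff_right two_ne_zero ENNReal.ofNat_ne_top).1 h3

theorem measure_isBestEnd_add (h : IsParetoField P xm α r) (hxm : 0 < xm) (hα : 0 < α)
    (m : ℕ) (v z : ℕ × ℕ) :
    P {ω | IsBestEnd (r ω) m v (v + z)} = P {ω | IsBestEnd (r ω) m (0, 0) z} := by
  simp only [isBestEnd_add_iff]
  exact h.measure_isBestEnd_comp hxm hα (add_right_injective v) m (0, 0) z

theorem tsum_measure_isBestEnd_mul_exp_le' (h : IsParetoField P xm α r) (hxm : 0 < xm)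
    (hα : 0 < α) (m : ℕ) (l : ℝ) (v : ℕ × ℕ) :
    ∑' w, P {ω | IsBestEnd (r ω) m v w} * ENNReal.ofReal (Real.exp (l * drift w)) ≤
      ENNReal.ofReal (Real.exp (l ^ 2 * m ^ 2 / 2)) *
        ENNReal.ofReal (Real.exp (l * drift v)) := by
  have h1 : ∑' w, P {ω | IsBestEnd (r ω) m v w} * ENNReal.ofReal (Real.exp (l * drift w)) =
      ∑' z, P {ω | IsBestEnd (r ω) m v (v + z)} *
        ENNReal.ofReal (Real.exp (l * drift (v + z))) := by
    refine ((add_right_injective v).tsum_eq (f := fun w =>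
      P {ω | IsBestEnd (r ω) m v w} * ENNReal.ofReal (Real.exp (l * drift w))) ?_).symm
    intro w hw
    by_contra hn
    refine hw ?_
    have : P {ω | IsBestEnd (r ω) m v w} = 0 :=
      measure_mono_null (t := ∅) (fun ω hω => hn ⟨w - v, add_tsub_cancel_of_le (IsBestEnd.le hω)⟩)
        measure_empty
    simp [this]
  rw [h1]
  refine le_trans (le_of_eq ?_)
    (mul_le_mul_left (h.tsum_measure_isBestEnd_mul_exp_le hxm hα m l) _)
  rw [← ENNReal.tsum_mul_right]
  refine tsum_congr fun z => ?_
  rw [h.measure_isBestEnd_add hxm hα, drift_add, mul_add, Real.exp_add,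
    mul_comm (Real.exp _), ENNReal.ofReal_mul (by positivity), mul_assoc]

/-- Reaching `v` depends on layers up to `k * m`, the next iteration on later ones. The start vertex
of a path is not counted, so these layers are disjoint. -/
theorem measure_isReachable_inter_isBestEnd (h : IsParetoField P xm α r) (m k : ℕ)
    (v w : ℕ × ℕ) : P ({ω | IsReachable (r ω) m k v} ∩ {ω | IsBestEnd (r ω) m v w}) =
      P {ω | IsReachable (r ω) m k v} * P {ω | IsBestEnd (r ω) m v w} := by
  by_cases hv : layer v = k * m
  · have hd : Disjoint {u : ℕ × ℕ | layer u ≤ k * m} {u | k * m < layer u} :=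
      Set.disjoint_left.2 fun u h1 h2 => absurd (show layer u ≤ k * m from h1) (not_le.2 h2)
    refine (Indep_iff _ _ _).1 (h.indep_rewardSigma hd) _ _ ?_ ?_
    · exact @measurableSet_isReachable _ (rewardSigma r _) _ _ _ _ fun u hu =>
        measurable_rewardSigma r hu
    · exact @_root_.measurableSet_isBestEnd _ (rewardSigma r _) _ _ _ _ fun u hu _ =>
        measurable_rewardSigma r (show k * m < layer u by omega)
  · have : {ω | IsReachable (r ω) m k v} = ∅ :=
      Set.eq_empty_of_forall_notMem fun ω hω => hv (IsReachable.layer_eq hω)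
    simp [this]

theorem measure_isReachable_succ_le (h : IsParetoField P xm α r) (m k : ℕ) (w : ℕ × ℕ) :
    P {ω | IsReachable (r ω) m (k + 1) w} ≤
      ∑' v, P {ω | IsReachable (r ω) m k v} * P {ω | IsBestEnd (r ω) m v w} := by
  simp only [← h.measure_isReachable_inter_isBestEnd]
  refine le_trans (measure_mono ?_) (measure_iUnion_le _)
  rintro ω ⟨v, hv, hvw⟩
  exact Set.mem_iUnion.2 ⟨v, hv, hvw⟩

/-- The start vertices of the iterations have exponential moments like those of a random walk. -/
theorem tsum_measure_isReachable_mul_exp_le (h : IsParetoField P xm α r) (hxm : 0 < xm)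
    (hα : 0 < α) (m k : ℕ) (l : ℝ) :
    ∑' w, P {ω | IsReachable (r ω) m k w} * ENNReal.ofReal (Real.exp (l * drift w)) ≤
      ENNReal.ofReal (Real.exp (l ^ 2 * m ^ 2 / 2)) ^ k := by
  have := h.isProbabilityMeasure hxm hα
  induction k with
  | zero =>
    rw [tsum_eq_single ((0, 0) : ℕ × ℕ)]
    · simp [drift, IsReachable]
    · intro w hw
      simp [IsReachable, hw]
  | succ k ih =>
    calc ∑' w, P {ω | IsReachable (r ω) m (k + 1) w} * ENNReal.ofReal (Real.exp (l * drift w))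
        ≤ ∑' w, ∑' v, P {ω | IsReachable (r ω) m k v} * (P {ω | IsBestEnd (r ω) m v w} *
            ENNReal.ofReal (Real.exp (l * drift w))) := by
          refine ENNReal.tsum_le_tsum fun w => ?_
          simp only [← mul_assoc]
          rw [ENNReal.tsum_mul_right]
          gcongr
          exact h.measure_isReachable_succ_le m k w
      _ = ∑' v, P {ω | IsReachable (r ω) m k v} * ∑' w, (P {ω | IsBestEnd (r ω) m v w} *
            ENNReal.ofReal (Real.exp (l * drift w))) := by
          rw [ENNReal.tsum_comm]
          simp only [ENNReal.tsum_mul_left]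
      _ ≤ ∑' v, P {ω | IsReachable (r ω) m k v} * (ENNReal.ofReal (Real.exp (l ^ 2 * m ^ 2 / 2)) *
            ENNReal.ofReal (Real.exp (l * drift v))) := by
          refine ENNReal.tsum_le_tsum fun v => ?_
          gcongr
          exact h.tsum_measure_isBestEnd_mul_exp_le' hxm hα m l v
      _ = ENNReal.ofReal (Real.exp (l ^ 2 * m ^ 2 / 2)) * ∑' v, P {ω | IsReachable (r ω) m k v} *
            ENNReal.ofReal (Real.exp (l * drift v)) := by
          rw [← ENNReal.tsum_mul_left]
          exact tsum_congr fun v => mul_left_comm _ _ _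
      _ ≤ _ := by
          rw [pow_succ' _ k]
          exact mul_le_mul' le_rfl ih

/-- With high probability, the planner with a short sensing range stays close to the diagonal. -/
theorem measure_exists_isReachable_le (h : IsParetoField P xm α r) (hxm : 0 < xm) (hα : 0 < α)
    {m d : ℕ} (hm : 1 ≤ m) {s : ℝ} (hs : 0 < s) :
    P {ω | ∃ k ≤ d, ∃ w, IsReachable (r ω) m k w ∧ s * (m * d) / 2 < |drift w|} ≤
      ENNReal.ofReal (2 * (d + 1) * Real.exp (-(s ^ 2 * d / 8))) := by
  have hm0 : (0 : ℝ) < m := by exact_mod_cast hm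
  set t : ℝ := s * (m * d) / 2 with ht
  have key : ∀ l : ℝ, ∀ k ≤ d, ∑' w, P {ω | IsReachable (r ω) m k w ∧ |l| * t < l * drift w} ≤
      ENNReal.ofReal (Real.exp (-(|l| * t) + l ^ 2 * m ^ 2 * d / 2)) := by
    intro l k hk
    calc ∑' w, P {ω | IsReachable (r ω) m k w ∧ |l| * t < l * drift w}
        ≤ ∑' w, ENNReal.ofReal (Real.exp (-(|l| * t))) * (P {ω | IsReachable (r ω) m k w} *
            ENNReal.ofReal (Real.exp (l * drift w))) := by
          refine ENNReal.tsum_le_tsum fun w => ?_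
          by_cases hw : |l| * t < l * drift w
          · simp only [hw, and_true]
            rw [mul_left_comm, ← ENNReal.ofReal_mul (by positivity), ← Real.exp_add]
            refine le_mul_of_one_le_right' (ENNReal.one_le_ofReal.2 (Real.one_le_exp ?_))
            linarith
          · simp [hw]
      _ ≤ ENNReal.ofReal (Real.exp (-(|l| * t))) *
            ENNReal.ofReal (Real.exp (l ^ 2 * m ^ 2 / 2)) ^ d := by
          rw [ENNReal.tsum_mul_left]
          gcongr
          refine (h.tsum_measure_isReachable_mul_exp_le hxm hα m k l).trans
            (pow_le_pow_right₀ (ENNReal.one_le_ofReal.2 (Real.one_le_exp (by positivity))) hk)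
      _ = _ := by
          rw [← ENNReal.ofReal_pow (by positivity), ← ENNReal.ofReal_mul (by positivity),
            ← Real.exp_nat_mul, ← Real.exp_add]
          ring_nf
  -- This `l` minimises the exponent `-(l * t) + l ^ 2 * m ^ 2 * d / 2`.
  set l : ℝ := s / (2 * m) with hl
  have hl0 : 0 < l := by positivity
  have he : -(l * t) + l ^ 2 * m ^ 2 * d / 2 = -(s ^ 2 * d / 8) := by
    rw [hl, ht]; field_simp; ring
  have key' : ∀ k ≤ d, P {ω | ∃ w, IsReachable (r ω) m k w ∧ t < |drift w|} ≤
      ENNReal.ofReal (2 * Real.exp (-(s ^ 2 * d / 8))) := by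
    intro k hk
    calc P {ω | ∃ w, IsReachable (r ω) m k w ∧ t < |drift w|}
        ≤ P ((⋃ w, {ω | IsReachable (r ω) m k w ∧ |l| * t < l * drift w}) ∪
            ⋃ w, {ω | IsReachable (r ω) m k w ∧ |-l| * t < -l * drift w}) := by
          refine measure_mono ?_
          rintro ω ⟨w, hw, hwt⟩
          rw [abs_neg, abs_of_pos hl0]
          rcases lt_abs.1 hwt with h1 | h1
          · exact Or.inl (Set.mem_iUnion.2 ⟨w, hw, mul_lt_mul_of_pos_left h1 hl0⟩)
          · refine Or.inr (Set.mem_iUnion.2 ⟨w, hw, ?_⟩)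
            have := mul_lt_mul_of_pos_left h1 hl0
            linarith
      _ ≤ _ := (measure_union_le _ _).trans (add_le_add (measure_iUnion_le _) (measure_iUnion_le _))
      _ ≤ _ := add_le_add (key l k hk) (key (-l) k hk)
      _ = _ := by
          rw [abs_neg, neg_sq, abs_of_pos hl0, he, ← ENNReal.ofReal_add (by positivity)
            (by positivity), two_mul]
  calc P {ω | ∃ k ≤ d, ∃ w, IsReachable (r ω) m k w ∧ t < |drift w|}
      ≤ P (⋃ k ∈ Finset.range (d + 1), {ω | ∃ w, IsReachable (r ω) m k w ∧ t < |drift w|}) := by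
        refine measure_mono ?_
        rintro ω ⟨k, hk, hw⟩
        exact Set.mem_biUnion (by simpa using Nat.lt_succ_of_le hk) hw
    _ ≤ ∑ k ∈ Finset.range (d + 1), P {ω | ∃ w, IsReachable (r ω) m k w ∧ t < |drift w|} :=
        measure_biUnion_finset_le _ _
    _ ≤ ∑ k ∈ Finset.range (d + 1), ENNReal.ofReal (2 * Real.exp (-(s ^ 2 * d / 8))) :=
        Finset.sum_le_sum fun k hk => key' k (Nat.lt_succ_iff.1 (Finset.mem_range.1 hk))
    _ = _ := by
        rw [Finset.sum_const, Finset.card_range, nsmul_eq_mul, ← ENNReal.ofReal_natCast,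
          ← ENNReal.ofReal_mul (by positivity)]
        push_cast
        ring_nf

end IsParetoField

/-! ### Counting high rewards on a path by chains -/

theorem layer_lt_layer {u v : ℕ × ℕ} (h : u < v) : layer u < layer v := by
  rcases Prod.lt_iff.1 h with ⟨h1, h2⟩ | ⟨h1, h2⟩ <;> simp only [layer] <;> omega

/-- The total weight of the strictly increasing chains of vertices with maximum `u`, where the
weight of a chain is the product of the weights of its vertices. -/
noncomputable def chainWeight (w : ℕ × ℕ → ℝ≥0∞) (u : ℕ × ℕ) : ℝ≥0∞ :=
  w u * (1 + ∑ u' ∈ (Finset.Iio u).attach, chainWeight w u'.1)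
termination_by layer u
decreasing_by exact layer_lt_layer (Finset.mem_Iio.1 u'.2)

theorem chainWeight_eq (w : ℕ × ℕ → ℝ≥0∞) (u : ℕ × ℕ) :
    chainWeight w u = w u * (1 + ∑ u' ∈ Finset.Iio u, chainWeight w u') := by
  rw [chainWeight, Finset.sum_attach (Finset.Iio u) (chainWeight w)]

/-- The total weight of all strictly increasing chains of vertices that are at most `v`,
including the empty chain. -/
noncomputable def chainSum (w : ℕ × ℕ → ℝ≥0∞) (v : ℕ × ℕ) : ℝ≥0∞ :=
  1 + ∑ u ∈ Finset.Iic v, chainWeight w u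

theorem chainSum_mono (w : ℕ × ℕ → ℝ≥0∞) : Monotone (chainSum w) := fun _ _ h =>
  add_le_add le_rfl (Finset.sum_le_sum_of_subset (Finset.Iic_subset_Iic.2 h))

/-- Each chain below `u` may be kept or extended by `v`, and these chains are all distinct. -/
theorem one_add_mul_chainSum_le (w : ℕ × ℕ → ℝ≥0∞) {u v : ℕ × ℕ} (h : u < v) :
    (1 + w v) * chainSum w u ≤ chainSum w v := by
  have h1 : chainSum w u ≤ 1 + ∑ u' ∈ Finset.Iio v, chainWeight w u' := by
    refine add_le_add le_rfl (Finset.sum_le_sum_of_subset fun x hx => ?_)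
    exact Finset.mem_Iio.2 ((Finset.mem_Iic.1 hx).trans_lt h)
  have h2 : chainSum w v = (1 + w v) * (1 + ∑ u' ∈ Finset.Iio v, chainWeight w u') := by
    rw [chainSum, ← Finset.Iio_insert v, Finset.sum_insert (by simp), chainWeight_eq w v]
    ring
  rw [h2]
  gcongr

theorem IsRoute.prod_one_add_le {γ : ℕ → ℕ × ℕ} (h : IsRoute γ) (w : ℕ × ℕ → ℝ≥0∞) (n : ℕ) :
    ∏ i ∈ Finset.range n, (1 + w (γ (i + 1))) ≤ chainSum w (γ n) := by
  induction n with
  | zero => simp [chainSum]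
  | succ n ih =>
    rw [Finset.prod_range_succ, mul_comm]
    exact (mul_le_mul' le_rfl ih).trans (one_add_mul_chainSum_le w (h.step n).lt)

theorem IsRoute.le_mk {γ : ℕ → ℕ × ℕ} (h : IsRoute γ) (n : ℕ) : γ n ≤ (n, n) := by
  have := h.layer_eq n
  simp only [layer] at this
  exact ⟨by show (γ n).1 ≤ n; omega, by show (γ n).2 ≤ n; omega⟩

/-- Every subset of the vertices of `A` on the route is a chain. The right side does not depend on
the route, so bounding its mean controls all routes at once. -/
theorem IsRoute.two_pow_card_le {γ : ℕ → ℕ × ℕ} (h : IsRoute γ) (A : Set (ℕ × ℕ)) (n : ℕ)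
    [DecidablePred (· ∈ A)] :
    (2 : ℝ≥0∞) ^ ((Finset.range n).filter fun i => γ (i + 1) ∈ A).card ≤
      chainSum (A.indicator 1) (n, n) := by
  refine le_trans (le_of_eq ?_)
    ((h.prod_one_add_le (A.indicator 1) n).trans (chainSum_mono _ (h.le_mk n)))
  rw [← Finset.prod_const, Finset.prod_filter]
  refine Finset.prod_congr rfl fun i _ => ?_
  by_cases hi : γ (i + 1) ∈ A
  · simp [hi, one_add_one_eq_two]
  · simp [hi]

/-- From `x + 1 ≤ exp x` at `x = N * log 2 - a`. With `a` at least the logarithm of the mean of `Y`,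
the last term has mean at most 2. -/
theorem natCast_le_of_two_pow_le {N : ℕ} {Y : ℝ≥0∞} (h : (2 : ℝ≥0∞) ^ N ≤ Y) {a : ℝ}
    (ha : 0 ≤ a) : (N : ℝ≥0∞) ≤ ENNReal.ofReal (2 * a) + 2 * ENNReal.ofReal (Real.exp (-a)) * Y := by
  have h1 : (N : ℝ) ≤ 2 * a + 2 * Real.exp (-a) * 2 ^ N := by
    have h2 : (N : ℝ) * Real.log 2 - a + 1 ≤ Real.exp (-a) * 2 ^ N := by
      have := Real.add_one_le_exp ((N : ℝ) * Real.log 2 - a)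
      refine this.trans (le_of_eq ?_)
      rw [sub_eq_add_neg, add_comm, Real.exp_add, Real.exp_nat_mul, Real.exp_log two_pos]
    have h3 : (1 / 2 : ℝ) ≤ Real.log 2 := by have := Real.log_two_gt_d9; linarith
    have h4 := mul_le_mul_of_nonneg_left h3 (Nat.cast_nonneg (α := ℝ) N)
    linarith
  calc (N : ℝ≥0∞) = ENNReal.ofReal N := (ENNReal.ofReal_natCast N).symm
    _ ≤ ENNReal.ofReal (2 * a + 2 * Real.exp (-a) * 2 ^ N) := ENNReal.ofReal_le_ofReal h1
    _ = ENNReal.ofReal (2 * a) + 2 * ENNReal.ofReal (Real.exp (-a)) * 2 ^ N := by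
      rw [ENNReal.ofReal_add (by positivity) (by positivity), ENNReal.ofReal_mul (by positivity),
        ENNReal.ofReal_mul (p := 2 * Real.exp (-a)) (by positivity),
        ENNReal.ofReal_mul (p := 2) (q := Real.exp (-a)) (by positivity),
        ENNReal.ofReal_pow (by positivity), ENNReal.ofReal_ofNat]
    _ ≤ _ := by gcongr

/-- The function `q ^ 2 * l ^ (layer u + 2)` is a supersolution of the chain recursion for vertex
probability `q ^ 2`. The double geometric sum factors as `(A - 1) * (B - 1)` with `A, B ≥ 1`, and `1
+ (A - 1) * (B - 1) ≤ A * B`. -/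
theorem one_add_sum_Iic_le {q l : ℝ} (hl : 1 ≤ l) (hql : q * l = l - 1)
    (v : ℕ × ℕ) : 1 + ∑ u ∈ Finset.Iic v, q ^ 2 * l ^ (layer u + 2) ≤ l ^ (layer v + 2) := by
  obtain ⟨a, b⟩ := v
  have h1 : ∑ u ∈ Finset.Iic (a, b), q ^ 2 * l ^ (layer u + 2) =
      ((∑ x ∈ Finset.range (a + 1), l ^ x) * (q * l)) *
        ((∑ y ∈ Finset.range (b + 1), l ^ y) * (q * l)) := by
    have h2 : Finset.Iic (a, b) = Finset.range (a + 1) ×ˢ Finset.range (b + 1) := by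
      ext ⟨x, y⟩
      simp
    rw [h2, Finset.sum_product, Finset.sum_mul (Finset.range (a + 1)),
      Finset.sum_mul (Finset.range (b + 1)), Finset.sum_mul_sum]
    refine Finset.sum_congr rfl fun x _ => Finset.sum_congr rfl fun y _ => ?_
    simp only [layer]
    ring
  rw [h1, hql, geom_sum_mul, geom_sum_mul]
  have hA : 1 ≤ l ^ (a + 1) := one_le_pow₀ hl
  have hB : 1 ≤ l ^ (b + 1) := one_le_pow₀ hl
  have : l ^ (layer (a, b) + 2) = l ^ (a + 1) * l ^ (b + 1) := by
    rw [← pow_add]; congr 1; simp only [layer]; ring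
  rw [this]
  nlinarith

theorem measurable_chainWeight {Ω : Type*} [MeasurableSpace Ω] {w : Ω → ℕ × ℕ → ℝ≥0∞}
    (u : ℕ × ℕ) (h : ∀ u' ≤ u, Measurable fun ω => w ω u') :
    Measurable fun ω => chainWeight (w ω) u := by
  induction hk : layer u using Nat.strong_induction_on generalizing u with
  | _ k ih =>
    simp only [chainWeight_eq _ u]
    refine (h u le_rfl).mul ((Finset.measurable_sum _ fun u' hu' => ?_).const_add 1)
    have hu := Finset.mem_Iio.1 hu'
    exact ih _ (hk ▸ layer_lt_layer hu) u' (fun x hx => h x (hx.trans hu.le)) rfl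

namespace IsParetoField

variable {Ω : Type*} [MeasurableSpace Ω] {P : Measure Ω} {xm α : ℝ} {r : Ω → ℕ × ℕ → ℝ}

theorem measurable_indicator_lt {Ω : Type*} [MeasurableSpace Ω] {r : Ω → ℕ × ℕ → ℝ} {u : ℕ × ℕ}
    (h : Measurable fun ω => r ω u) (t : ℝ) :
    Measurable fun ω => {v | t < r ω v}.indicator (1 : ℕ × ℕ → ℝ≥0∞) u :=
  measurable_const.indicator (s := {ω | t < r ω u}) (f := fun _ : Ω => (1 : ℝ≥0∞))
    (measurableSet_lt measurable_const h)

theorem lintegral_indicator_lt_le (h : IsParetoField P xm α r) (hxm : 0 < xm) (hα : 0 < α)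
    {t : ℝ} (ht : 0 < t) (u : ℕ × ℕ) :
    ∫⁻ ω, {v | t < r ω v}.indicator (1 : ℕ × ℕ → ℝ≥0∞) u ∂P ≤ ENNReal.ofReal ((xm / t) ^ α) := by
  have h1 : MeasurableSet {ω | t < r ω u} := measurableSet_lt measurable_const (h.measurable u)
  refine le_trans (le_of_eq ?_) (paretoMeasure_Ioi_le hxm hα ht)
  rw [← h.measure_preimage u measurableSet_Ioi]
  exact lintegral_indicator_one h1

/-- The reward at `u` is independent of those strictly below `u`, so the mean factors in the
recursion, and induction on the layer applies. -/
theorem lintegral_chainWeight_le (h : IsParetoField P xm α r) (hxm : 0 < xm) (hα : 0 < α)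
    {t q l : ℝ} (ht : 0 < t) (hl : 1 ≤ l) (hql : q * l = l - 1)
    (hqt : (xm / t) ^ α = q ^ 2) (u : ℕ × ℕ) :
    ∫⁻ ω, chainWeight ({v | t < r ω v}.indicator 1) u ∂P ≤
      ENNReal.ofReal (q ^ 2 * l ^ (layer u + 2)) := by
  have := h.isProbabilityMeasure hxm hα
  induction hk : layer u using Nat.strong_induction_on generalizing u with
  | _ k ih =>
    subst hk
    simp only [chainWeight_eq _ u]
    have hm : ∀ S : Set (ℕ × ℕ), ∀ u ∈ S, Measurable[rewardSigma r S]
        fun ω => {v | t < r ω v}.indicator (1 : ℕ × ℕ → ℝ≥0∞) u := fun S u hu =>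
      @measurable_indicator_lt _ (rewardSigma r S) _ _ (measurable_rewardSigma r hu) t
    have hd : Disjoint {u} (Set.Iio u) := by simp
    have hm' : ∀ u' ∈ Finset.Iio u, Measurable[rewardSigma r (Set.Iio u)]
        fun ω => chainWeight ({v | t < r ω v}.indicator 1) u' := fun u' hu' =>
      @_root_.measurable_chainWeight _ (rewardSigma r (Set.Iio u)) _ u' fun x hx =>
        hm _ x (hx.trans_lt (Finset.mem_Iio.1 hu'))
    have hm1 : Measurable[rewardSigma r (Set.Iio u)]
        fun ω => 1 + ∑ u' ∈ Finset.Iio u, chainWeight ({v | t < r ω v}.indicator 1) u' :=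
      Measurable.add (m := rewardSigma r (Set.Iio u)) measurable_const
        (@Finset.measurable_sum _ _ _ _ _ _ (rewardSigma r (Set.Iio u)) _ _ hm')
    rw [lintegral_mul_eq_lintegral_mul_lintegral_of_independent_measurableSpace
      (h.rewardSigma_le {u}) (h.rewardSigma_le (Set.Iio u)) (h.indep_rewardSigma hd)
      (hm {u} u rfl) hm1,
      lintegral_add_left measurable_const, lintegral_const, measure_univ, one_mul,
      lintegral_finsetSum _ fun u' hu' => (hm' u' hu').mono (h.rewardSigma_le _) le_rfl,
      ENNReal.ofReal_mul (sq_nonneg q)]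
    refine mul_le_mul' (hqt ▸ h.lintegral_indicator_lt_le hxm hα ht u) ?_
    refine le_trans ?_ (ENNReal.ofReal_le_ofReal (one_add_sum_Iic_le hl hql u))
    rw [ENNReal.ofReal_add zero_le_one (Finset.sum_nonneg fun _ _ => by positivity),
      ENNReal.ofReal_one, ENNReal.ofReal_sum_of_nonneg fun _ _ => by positivity]
    gcongr 1 + ?_
    calc _ ≤ ∑ u' ∈ Finset.Iio u, ENNReal.ofReal (q ^ 2 * l ^ (layer u' + 2)) :=
          Finset.sum_le_sum fun u' hu' => ih _ (layer_lt_layer (Finset.mem_Iio.1 hu')) u' rfl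
      _ ≤ _ := Finset.sum_le_sum_of_subset fun x hx => Finset.mem_Iic.2 (Finset.mem_Iio.1 hx).le

theorem measurable_chainWeight (h : IsParetoField P xm α r) (t : ℝ) (u : ℕ × ℕ) :
    Measurable fun ω => chainWeight ({v | t < r ω v}.indicator 1) u :=
  _root_.measurable_chainWeight u fun x _ => measurable_indicator_lt (h.measurable x) t

theorem measurable_chainSum (h : IsParetoField P xm α r) (t : ℝ) (u : ℕ × ℕ) :
    Measurable fun ω => chainSum ({v | t < r ω v}.indicator 1) u :=
  (Finset.measurable_sum _ fun u' _ => h.measurable_chainWeight t u').const_add 1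

theorem lintegral_chainSum_le (h : IsParetoField P xm α r) (hxm : 0 < xm) (hα : 0 < α)
    {t q l : ℝ} (ht : 0 < t) (hl : 1 ≤ l) (hql : q * l = l - 1)
    (hqt : (xm / t) ^ α = q ^ 2) (u : ℕ × ℕ) :
    ∫⁻ ω, chainSum ({v | t < r ω v}.indicator 1) u ∂P ≤ ENNReal.ofReal (l ^ (layer u + 2)) := by
  have := h.isProbabilityMeasure hxm hα
  have hm : ∀ u' ∈ Finset.Iic u, Measurable fun ω =>
      chainWeight ({v | t < r ω v}.indicator 1) u' := fun u' _ => h.measurable_chainWeight t u'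
  simp only [chainSum]
  rw [lintegral_add_left measurable_const, lintegral_const, measure_univ, one_mul,
    lintegral_finsetSum _ hm]
  refine le_trans ?_ (ENNReal.ofReal_le_ofReal (one_add_sum_Iic_le hl hql u))
  rw [ENNReal.ofReal_add zero_le_one (Finset.sum_nonneg fun _ _ => by positivity),
    ENNReal.ofReal_one, ENNReal.ofReal_sum_of_nonneg fun _ _ => by positivity]
  gcongr 1 + ?_
  exact Finset.sum_le_sum fun u' _ => h.lintegral_chainWeight_le hxm hα ht hl hql hqt u'

/-- The number of vertices with a reward above `t` on a directed path with `n` steps is of order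
at most `n (xm / t) ^ (α / 2)`. -/
theorem exists_card_lt_le (h : IsParetoField P xm α r) (hxm : 0 < xm) (hα : 0 < α)
    {t : ℝ} (ht : 0 < t) {n : ℕ} (hn : 1 ≤ n) : ∃ N : Ω → ℝ≥0∞, Measurable N ∧
      ∫⁻ ω, N ω ∂P ≤ ENNReal.ofReal (16 * n * (xm / t) ^ (α / 2)) + 2 ∧
      ∀ ω γ, IsRoute γ →
        (((Finset.range n).filter fun i => t < r ω (γ (i + 1))).card : ℝ≥0∞) ≤ N ω := by
  have := h.isProbabilityMeasure hxm hα
  have hn1 : (1 : ℝ) ≤ n := by exact_mod_cast hn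
  -- For `t ≥ xm`, this is the square root of the probability that a reward exceeds `t`.
  set q : ℝ := (xm / t) ^ (α / 2) with hq
  have hq0 : 0 ≤ q := by positivity
  have hqt : (xm / t) ^ α = q ^ 2 := by
    rw [hq, ← Real.rpow_natCast, ← Real.rpow_mul (by positivity)]
    congr 1
    push_cast
    ring
  rcases le_or_gt q (1 / 2) with hq2 | hq2
  · have hq1 : 0 < 1 - q := by linarith
    set l : ℝ := (1 - q)⁻¹ with hl
    have hl1 : 1 ≤ l := (one_le_inv₀ hq1).2 (by linarith)
    have hql : q * l = l - 1 := by rw [hl]; field_simp; ring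
    have hle : l ≤ Real.exp (2 * q) := by
      rw [hl, inv_le_iff_one_le_mul₀ hq1]
      have h1 := mul_le_mul_of_nonneg_right (Real.add_one_le_exp (2 * q)) hq1.le
      nlinarith
    have hpow : l ^ (layer (n, n) + 2) ≤ Real.exp (8 * n * q) := by
      refine (pow_le_pow_left₀ (by positivity) hle _).trans ?_
      rw [← Real.exp_nat_mul]
      refine Real.exp_le_exp.2 ?_
      simp only [layer]
      push_cast
      nlinarith
    -- The value `a = 8 * n * q` comes from `hpow`, which bounds the logarithm of the mean chain
    -- sum.
    refine ⟨fun ω => ENNReal.ofReal (2 * (8 * n * q)) + 2 * ENNReal.ofReal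
      (Real.exp (-(8 * n * q))) * chainSum ({v | t < r ω v}.indicator 1) (n, n), ?_, ?_, ?_⟩
    · exact (h.measurable_chainSum t (n, n)).const_mul _ |>.const_add _
    · rw [lintegral_add_left measurable_const, lintegral_const, measure_univ, mul_one,
        lintegral_const_mul' _ _ (by finiteness)]
      refine add_le_add (le_of_eq (by ring_nf)) ?_
      calc _ ≤ 2 * ENNReal.ofReal (Real.exp (-(8 * n * q))) *
            ENNReal.ofReal (Real.exp (8 * n * q)) := by
              gcongr
              exact (h.lintegral_chainSum_le hxm hα ht hl1 hql hqt _).trans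
                (ENNReal.ofReal_le_ofReal hpow)
        _ = 2 := by
            rw [mul_assoc, ← ENNReal.ofReal_mul (by positivity), ← Real.exp_add]
            simp
    · intro ω γ hγ
      classical
      exact natCast_le_of_two_pow_le (hγ.two_pow_card_le {v | t < r ω v} n) (by positivity)
  -- For `q > 1 / 2`, the trivial bound `n` is below `16 * n * q`.
  · refine ⟨fun _ => n, measurable_const, ?_, fun ω γ _ => ?_⟩
    · rw [lintegral_const, measure_univ, mul_one, ← ENNReal.ofReal_natCast]
      refine le_add_right (ENNReal.ofReal_le_ofReal ?_)
      nlinarith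
    · have := Finset.card_filter_le (Finset.range n) fun i => t < r ω (γ (i + 1))
      rw [Finset.card_range] at this
      exact Nat.cast_le.2 this

end IsParetoField

/-! ### Estimates for truncated path sums, the optimum and the strip -/

namespace IsParetoField

variable {Ω : Type*} [MeasurableSpace Ω] {P : Measure Ω} {xm α : ℝ} {r : Ω → ℕ × ℕ → ℝ}

/-- The reward of a directed path with at most `n` steps none of whose rewards exceeds `L` is of
order at most `n L ^ (1 - α / 2) + L`. -/
theorem exists_truncated_bound (hxm : 0 < xm) (hα : 0 < α) (hα2 : α < 2) :
    ∃ C : ℝ, 0 < C ∧ ∀ {Ω : Type*} [MeasurableSpace Ω] {P : Measure Ω} {r : Ω → ℕ × ℕ → ℝ},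
      IsParetoField P xm α r → ∀ {L : ℝ} {n : ℕ}, 0 < L → 1 ≤ n →
      ∃ W : Ω → ℝ≥0∞, Measurable W ∧
        ∫⁻ ω, W ω ∂P ≤ ENNReal.ofReal (C * (n * L ^ (1 - α / 2) + L)) ∧
        ∀ ω γ, IsRoute γ → (∀ u, 0 < r ω u) → ∀ n' ≤ n, (∀ i < n', r ω (γ (i + 1)) ≤ L) →
          ENNReal.ofReal (∑ i ∈ Finset.range n', r ω (γ (i + 1))) ≤ W ω := by
  set b : ℝ := 2 ^ (α / 2) with hb
  have hb0 : 0 < b := by positivity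
  -- Here `α < 2` enters: `b / 2` is the ratio of the geometric series over dyadic levels.
  have hb2 : b < 2 := by
    calc b < 2 ^ (1 : ℝ) := Real.rpow_lt_rpow_of_exponent_lt one_lt_two (by linarith)
      _ = 2 := Real.rpow_one 2
  have hκ : 0 < 1 - b / 2 := by linarith
  refine ⟨16 * xm ^ (α / 2) * b * (1 - b / 2)⁻¹ + 4, by positivity, ?_⟩
  intro Ω _ P r h L n hL hn
  have hn1 : (1 : ℝ) ≤ n := by exact_mod_cast hn
  have ht : ∀ j : ℕ, 0 < L * (1 / 2) ^ (j + 1) := fun j => by positivity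
  choose N hN1 hN2 hN3 using fun j => h.exists_card_lt_le hxm hα (ht j) hn
  -- Rewards in `(L / 2 ^ (j + 1), L / 2 ^ j]` are at most `N j` in number on a route, each at most
  -- `L / 2 ^ j`.
  refine ⟨fun ω => ∑' j, ENNReal.ofReal (L * (1 / 2) ^ j) * N j ω,
    Measurable.tsum fun j => (hN1 j).const_mul _, ?_, ?_⟩
  · have hterm : ∀ j : ℕ, L * (1 / 2) ^ j * (16 * n * (xm / (L * (1 / 2) ^ (j + 1))) ^ (α / 2) + 2) =
        16 * n * xm ^ (α / 2) * b * L ^ (1 - α / 2) * (b / 2) ^ j + 2 * L * (1 / 2) ^ j := by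
      intro j
      have e1 : (xm / (L * (1 / 2) ^ (j + 1))) ^ (α / 2) =
          xm ^ (α / 2) / L ^ (α / 2) * (b * b ^ j) := by
        have e2 : xm / (L * (1 / 2) ^ (j + 1)) = xm / L * 2 ^ (j + 1) := by
          rw [one_div, inv_pow]; field_simp
        rw [e2, Real.mul_rpow (by positivity) (by positivity), Real.div_rpow hxm.le hL.le,
          ← pow_succ', hb, ← Real.rpow_natCast, ← Real.rpow_natCast, ← Real.rpow_mul two_pos.le,
          ← Real.rpow_mul two_pos.le, mul_comm (α / 2)]
      rw [e1, Real.rpow_sub hL, Real.rpow_one, div_pow, div_pow, one_pow]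
      field_simp
    have hsum1 : HasSum (fun j : ℕ => 16 * n * xm ^ (α / 2) * b * L ^ (1 - α / 2) * (b / 2) ^ j +
        2 * L * (1 / 2) ^ j) (16 * n * xm ^ (α / 2) * b * L ^ (1 - α / 2) * (1 - b / 2)⁻¹ +
          2 * L * 2) :=
      ((hasSum_geometric_of_lt_one (by positivity) (by linarith)).mul_left _).add
        (hasSum_geometric_two.mul_left _)
    calc ∫⁻ ω, ∑' j, ENNReal.ofReal (L * (1 / 2) ^ j) * N j ω ∂P
        = ∑' j, ENNReal.ofReal (L * (1 / 2) ^ j) * ∫⁻ ω, N j ω ∂P := by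
          rw [lintegral_tsum fun j => ((hN1 j).const_mul _).aemeasurable]
          exact tsum_congr fun j => lintegral_const_mul _ (hN1 j)
      _ ≤ ∑' j : ℕ, ENNReal.ofReal (16 * n * xm ^ (α / 2) * b * L ^ (1 - α / 2) * (b / 2) ^ j +
            2 * L * (1 / 2) ^ j) := by
          refine ENNReal.tsum_le_tsum fun j => ?_
          rw [← hterm, ENNReal.ofReal_mul (p := L * (1 / 2) ^ j) (by positivity),
            ENNReal.ofReal_add (by positivity) two_pos.le, ENNReal.ofReal_ofNat]
          gcongr
          exact hN2 j
      _ = ENNReal.ofReal (16 * n * xm ^ (α / 2) * b * L ^ (1 - α / 2) * (1 - b / 2)⁻¹ +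
            2 * L * 2) := by
          rw [← ENNReal.ofReal_tsum_of_nonneg (fun j => by positivity) hsum1.summable,
            hsum1.tsum_eq]
      _ ≤ _ := by
          refine ENNReal.ofReal_le_ofReal ?_
          have h1 : 0 ≤ 16 * xm ^ (α / 2) * b * (1 - b / 2)⁻¹ * L := by positivity
          have h2 : 0 ≤ n * L ^ (1 - α / 2) := by positivity
          nlinarith
  · intro ω γ hγ hpos n' hn' hle
    have hone : ∀ i < n', ENNReal.ofReal (r ω (γ (i + 1))) ≤
        ∑' j, ENNReal.ofReal (L * (1 / 2) ^ j) *
          if L * (1 / 2) ^ (j + 1) < r ω (γ (i + 1)) then 1 else 0 := by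
      intro i hi
      obtain ⟨j, hj1, hj2⟩ := exists_nat_pow_near_of_lt_one
        (div_pos (hpos (γ (i + 1))) hL) ((div_le_one hL).2 (hle i hi)) (y := (1 / 2 : ℝ))
        (by norm_num) (by norm_num)
      rw [lt_div_iff₀ hL, mul_comm] at hj1
      rw [div_le_iff₀ hL, mul_comm] at hj2
      refine le_trans ?_ (ENNReal.le_tsum j)
      rw [if_pos hj1, mul_one]
      exact ENNReal.ofReal_le_ofReal hj2
    rw [ENNReal.ofReal_sum_of_nonneg fun i _ => (hpos _).le]
    calc ∑ i ∈ Finset.range n', ENNReal.ofReal (r ω (γ (i + 1)))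
        ≤ ∑ i ∈ Finset.range n', ∑' j, ENNReal.ofReal (L * (1 / 2) ^ j) *
          (if L * (1 / 2) ^ (j + 1) < r ω (γ (i + 1)) then 1 else 0) :=
          Finset.sum_le_sum fun i hi => hone i (Finset.mem_range.1 hi)
      _ = ∑' j, ENNReal.ofReal (L * (1 / 2) ^ j) * ∑ i ∈ Finset.range n',
          (if L * (1 / 2) ^ (j + 1) < r ω (γ (i + 1)) then 1 else 0) := by
          rw [← Summable.tsum_finsetSum fun _ _ => ENNReal.summable]
          exact tsum_congr fun j => (Finset.mul_sum _ _ _).symm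
      _ ≤ _ := by
          refine ENNReal.tsum_le_tsum fun j => mul_le_mul' le_rfl (le_trans ?_ (hN3 j ω γ hγ))
          rw [Finset.sum_boole]
          exact Nat.cast_le.2 (Finset.card_le_card (Finset.filter_subset_filter _
            (Finset.range_subset_range.2 hn')))

/-- Rewards of order `n ^ (2 / α)` are available within `n` steps. -/
theorem exists_measure_forall_le_le (hxm : 0 < xm) (hα : 0 < α) {δ : ℝ} (hδ : 0 < δ) :
    ∃ c : ℝ, 0 < c ∧ ∀ {Ω : Type*} [MeasurableSpace Ω] {P : Measure Ω} {r : Ω → ℕ × ℕ → ℝ},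
      IsParetoField P xm α r → ∀ {n : ℕ}, 1 ≤ n →
      P {ω | ∀ u, 1 ≤ layer u → layer u ≤ n → r ω u ≤ c * n ^ (2 / α)} ≤ ENNReal.ofReal δ := by
  obtain ⟨K, hK0, hK⟩ : ∃ K : ℝ, 0 < K ∧ Real.exp (-(K / 4)) ≤ δ := by
    refine ⟨4 * max 1 (-Real.log δ), by positivity, ?_⟩
    rw [← Real.le_log_iff_exp_le hδ]
    have := le_max_right 1 (-Real.log δ)
    linarith
  -- This makes a reward exceed the threshold `t` with probability about `K / n ^ 2`. With at least
  -- `n ^ 2 / 4` vertices, all fail with probability at most `exp (-(K / 4))`.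
  refine ⟨xm * K ^ (-(1 / α)), by positivity, ?_⟩
  intro Ω _ P r h n hn
  have := h.isProbabilityMeasure hxm hα
  have hn0 : (0 : ℝ) < n := by exact_mod_cast hn
  set t : ℝ := xm * K ^ (-(1 / α)) * n ^ (2 / α) with ht
  have ht0 : 0 < t := by positivity
  have htα : (xm / t) ^ α = K / n ^ 2 := by
    have e1 : xm / t = K ^ (1 / α) * (n : ℝ) ^ (-(2 / α)) := by
      rw [ht, Real.rpow_neg hK0.le, Real.rpow_neg hn0.le]
      field_simp
    rw [e1, Real.mul_rpow (by positivity) (by positivity), ← Real.rpow_mul hK0.le,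
      ← Real.rpow_mul hn0.le, one_div_mul_cancel hα.ne', Real.rpow_one, neg_mul,
      div_mul_cancel₀ _ hα.ne', Real.rpow_neg hn0.le, Real.rpow_two, div_eq_mul_inv]
  -- The `k` by `k` square, shifted by one to avoid the origin, has layers between `1` and `2 * k -
  -- 1 ≤ n`.
  set k := (n + 1) / 2 with hk
  have hf : Function.Injective fun u : ℕ × ℕ => (u.1 + 1, u.2) := by
    rintro ⟨a, b⟩ ⟨c, d⟩ h
    simpa using h
  have h' := h.precomp hf
  calc P {ω | ∀ u, 1 ≤ layer u → layer u ≤ n → r ω u ≤ t}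
      ≤ P (⋂ u ∈ Finset.range k ×ˢ Finset.range k,
          (fun ω => r ω (u.1 + 1, u.2)) ⁻¹' Set.Iic t) := by
        refine measure_mono fun ω hω => Set.mem_iInter₂.2 fun u hu => hω _ ?_ ?_
        · simp only [layer]; omega
        · have := Finset.mem_product.1 hu
          simp only [Finset.mem_range] at this
          simp only [layer]; omega
    _ = ∏ u ∈ Finset.range k ×ˢ Finset.range k, P ((fun ω => r ω (u.1 + 1, u.2)) ⁻¹' Set.Iic t) :=
        h'.indep.measure_inter_preimage_eq_mul _ fun _ _ => measurableSet_Iic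
    _ ≤ ∏ _u ∈ Finset.range k ×ˢ Finset.range k, ENNReal.ofReal (Real.exp (-(xm / t) ^ α)) := by
        refine Finset.prod_le_prod' fun u _ => ?_
        exact (h.measure_preimage (u.1 + 1, u.2) measurableSet_Iic).le.trans
          (paretoMeasure_Iic_le hxm hα ht0)
    _ = ENNReal.ofReal (Real.exp (-(k * k * (K / n ^ 2)))) := by
        rw [Finset.prod_const, Finset.card_product, Finset.card_range, htα,
          ← ENNReal.ofReal_pow (by positivity), ← Real.exp_nat_mul]
        push_cast
        ring_nf
    _ ≤ ENNReal.ofReal δ := by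
        refine ENNReal.ofReal_le_ofReal (le_trans (Real.exp_le_exp.2 ?_) hK)
        have h1 : (n : ℝ) / 2 ≤ k := by
          have : n ≤ 2 * k := by omega
          have : (n : ℝ) ≤ 2 * k := by exact_mod_cast this
          linarith
        have h2 : (n : ℝ) ^ 2 / 4 ≤ k * k := by nlinarith
        have h3 := mul_le_mul_of_nonneg_right h2 (by positivity : 0 ≤ K / (n : ℝ) ^ 2)
        have h4 : (n : ℝ) ^ 2 / 4 * (K / n ^ 2) = K / 4 := by field_simp
        linarith

/-- Rewards of order `n ^ (2 / α)` are rare in a narrow strip around the diagonal. -/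
theorem exists_measure_strip_le (hxm : 0 < xm) (hα : 0 < α) {η δ : ℝ} (hη : 0 < η) (hδ : 0 < δ) :
    ∃ s : ℝ, 0 < s ∧ ∀ {Ω : Type*} [MeasurableSpace Ω] {P : Measure Ω} {r : Ω → ℕ × ℕ → ℝ},
      IsParetoField P xm α r → ∀ {n : ℕ}, 1 ≤ n → 1 ≤ s * n →
      P {ω | ∃ u, layer u ≤ n ∧ |drift u| ≤ s * n ∧ η * n ^ (2 / α) < r ω u} ≤
        ENNReal.ofReal δ := by
  -- The strip has at most `2 * n * (3 * (s * n))` vertices, each with a large reward with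
  -- probability at most `(xm / η) ^ α / n ^ 2`.
  refine ⟨δ / (6 * (xm / η) ^ α), by positivity, ?_⟩
  set s := δ / (6 * (xm / η) ^ α) with hs
  intro Ω _ P r h n hn hsn
  have hn1 : (1 : ℝ) ≤ n := by exact_mod_cast hn
  have hn0 : (0 : ℝ) < n := by linarith
  set t := η * (n : ℝ) ^ (2 / α) with ht
  have ht0 : 0 < t := by positivity
  have htα : (xm / t) ^ α = (xm / η) ^ α / n ^ 2 := by
    rw [ht, ← div_div, Real.div_rpow (by positivity) (by positivity), ← Real.rpow_mul hn0.le,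
      div_mul_cancel₀ _ hα.ne', Real.rpow_two]
  -- The vertex `(x, y)` of the strip is indexed by `(x, y + H - x)`. Truncated subtraction only
  -- adds vertices to the union.
  set H := ⌊s * n⌋₊ with hH
  calc P {ω | ∃ u, layer u ≤ n ∧ |drift u| ≤ s * n ∧ t < r ω u}
      ≤ P (⋃ z ∈ Finset.range (n + 1) ×ˢ Finset.range (2 * H + 1),
          {ω | r ω (z.1, z.1 + z.2 - H) ∈ Set.Ioi t}) := by
        refine measure_mono ?_
        rintro ω ⟨⟨x, y⟩, hu, hd, hr⟩
        simp only [layer] at hu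
        simp only [drift] at hd
        obtain ⟨hd1, hd2⟩ := abs_le.1 hd
        have h1 : x - y ≤ H := by
          refine Nat.le_floor ?_
          rcases le_total x y with hxy | hxy
          · rw [Nat.sub_eq_zero_of_le hxy]; push_cast; linarith
          · rw [Nat.cast_sub hxy]; exact hd2
        have h2 : y - x ≤ H := by
          refine Nat.le_floor ?_
          rcases le_total y x with hxy | hxy
          · rw [Nat.sub_eq_zero_of_le hxy]; push_cast; linarith
          · rw [Nat.cast_sub hxy]; linarith
        refine Set.mem_biUnion (x := (x, y + H - x)) ?_ ?_
        · simp only [Finset.coe_product, Set.mem_prod, Finset.coe_range, Set.mem_Iio]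
          omega
        · have h3 : x + (y + H - x) - H = y := by omega
          show t < r ω (x, x + (y + H - x) - H)
          rwa [h3]
    _ ≤ ∑ z ∈ Finset.range (n + 1) ×ˢ Finset.range (2 * H + 1),
          P {ω | r ω (z.1, z.1 + z.2 - H) ∈ Set.Ioi t} := measure_biUnion_finset_le _ _
    _ ≤ ∑ _z ∈ Finset.range (n + 1) ×ˢ Finset.range (2 * H + 1),
          ENNReal.ofReal ((xm / t) ^ α) := by
        refine Finset.sum_le_sum fun z _ => ?_
        rw [h.measure_preimage _ measurableSet_Ioi]
        exact paretoMeasure_Ioi_le hxm hα ht0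
    _ = ENNReal.ofReal ((n + 1) * (2 * H + 1) * ((xm / η) ^ α / n ^ 2)) := by
        rw [Finset.sum_const, Finset.card_product, Finset.card_range, Finset.card_range, htα,
          nsmul_eq_mul, ← ENNReal.ofReal_natCast, ← ENNReal.ofReal_mul (by positivity)]
        push_cast
        rfl
    _ ≤ ENNReal.ofReal δ := by
        refine ENNReal.ofReal_le_ofReal ?_
        have h1 : (H : ℝ) ≤ s * n := Nat.floor_le (by linarith)
        calc (n + 1) * (2 * H + 1) * ((xm / η) ^ α / n ^ 2)
            ≤ (2 * n) * (3 * (s * n)) * ((xm / η) ^ α / n ^ 2) := by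
              gcongr <;> linarith
          _ = δ := by rw [hs]; field_simp; norm_num

end IsParetoField

/-! ### The planner is far from optimal outside small events -/

namespace IsParetoField

variable {Ω : Type*} [MeasurableSpace Ω] {P : Measure Ω} {xm α : ℝ} {r : Ω → ℕ × ℕ → ℝ}

/-- Rewards below a small multiple of `n ^ (2 / α)` contribute little to every path. -/
theorem exists_truncation_level (h : IsParetoField P xm α r) (hxm : 0 < xm) (hα : 0 < α)
    (hα2 : α < 2) {a δ : ℝ} (ha : 0 < a) (hδ : 0 < δ) :
    ∃ η : ℝ, 0 < η ∧ ∀ n : ℕ, 1 ≤ n → ∃ B : Set Ω, P B ≤ ENNReal.ofReal δ ∧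
      ∀ ω ∉ B, ∀ γ, IsRoute γ → (∀ u, 0 < r ω u) → ∀ n' ≤ n,
        (∀ i < n', r ω (γ (i + 1)) ≤ η * n ^ (2 / α)) →
          ∑ i ∈ Finset.range n', r ω (γ (i + 1)) ≤ a * n ^ (2 / α) := by
  obtain ⟨C, hC, hW⟩ := exists_truncated_bound hxm hα hα2
  have hexp : 0 < 1 - α / 2 := by linarith
  obtain ⟨η, hη, hηC⟩ : ∃ η : ℝ, 0 < η ∧ C * (η ^ (1 - α / 2) + η) ≤ δ * a := by
    have h1 : Tendsto (fun η : ℝ => C * (η ^ (1 - α / 2) + η)) (𝓝[>] 0) (𝓝 0) := by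
      have h2 : ContinuousAt (fun η : ℝ => C * (η ^ (1 - α / 2) + η)) 0 :=
        continuousAt_const.mul ((Real.continuousAt_rpow_const _ _ (Or.inr hexp.le)).add
          continuousAt_id)
      have h3 := h2.tendsto.mono_left (nhdsWithin_le_nhds (s := Set.Ioi 0))
      simpa [Real.zero_rpow hexp.ne'] using h3
    obtain ⟨η, h4, h5⟩ := ((h1.eventually (gt_mem_nhds (mul_pos hδ ha))).and
      self_mem_nhdsWithin).exists
    exact ⟨η, h5, le_of_lt h4⟩
  refine ⟨η, hη, fun n hn => ?_⟩
  have hn0 : (0 : ℝ) < n := by exact_mod_cast hn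
  set s : ℝ := (n : ℝ) ^ (2 / α) with hs
  have hs0 : 0 < s := by positivity
  obtain ⟨W, hWm, hW1, hW2⟩ := hW h (mul_pos hη hs0) hn
  have hns : C * (n * (η * s) ^ (1 - α / 2) + η * s) = C * (η ^ (1 - α / 2) + η) * s := by
    -- The scaling identity that makes `n ^ (2 / α)` the critical level: both terms of the truncated
    -- bound have order `s`.
    have : (n : ℝ) * s ^ (1 - α / 2) = s := by
      rw [hs, ← Real.rpow_mul hn0.le, ← Real.rpow_one_add' hn0.le]
      · congr 1; field_simp; ring
      · have : 1 + 2 / α * (1 - α / 2) = 2 / α := by field_simp; ring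
        rw [this]; positivity
    rw [Real.mul_rpow hη.le hs0.le]
    linear_combination C * η ^ (1 - α / 2) * this
  refine ⟨{ω | ENNReal.ofReal (a * s) ≤ W ω}, ?_, ?_⟩
  · have has : 0 < a * s := by positivity
    refine (meas_ge_le_lintegral_div hWm.aemeasurable (by simpa using has)
      ENNReal.ofReal_ne_top).trans ?_
    refine ENNReal.div_le_of_le_mul ?_
    rw [← ENNReal.ofReal_mul hδ.le]
    refine hW1.trans (ENNReal.ofReal_le_ofReal ?_)
    rw [hns, ← mul_assoc]
    exact mul_le_mul_of_nonneg_right hηC hs0.le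
  · intro ω hω γ hγ hpos n' hn' hle
    have h1 : W ω < ENNReal.ofReal (a * s) := not_le.1 hω
    have h2 := (hW2 ω γ hγ hpos n' hn' hle).trans_lt h1
    exact (ENNReal.lt_ofReal_iff_toReal_lt ENNReal.ofReal_ne_top).1 h2 |>.le.trans' (by
      rw [ENNReal.toReal_ofReal (Finset.sum_nonneg fun i _ => (hpos _).le)])

/-- Outside a small event that does not depend on the sensing range `m`, and another one whose
probability is summable in `n / m`, the planner is far from optimal. -/
theorem exists_bad_events (h : IsParetoField P xm α r) (hxm : 0 < xm) (hα : 0 < α) (hα2 : α < 2)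
    {ε δ : ℝ} (hε : 0 < ε) (hδ : 0 < δ) :
    ∃ (D : ℕ) (e : ℕ → ℝ≥0∞), ∑' d, e d ≠ ∞ ∧ ∀ n, ∃ B : Set Ω, P B ≤ ENNReal.ofReal δ ∧
      ∀ m, 1 ≤ m → D ≤ n / m → ∃ E : Set Ω, P E ≤ e (n / m) ∧ ∀ ω, ω ∉ B → ω ∉ E →
        ∀ v, IsPlannerRun (r ω) m v →
          0 ≤ iterativeMeanReward (r ω) v n m / optimalMeanReward (r ω) n ∧
          iterativeMeanReward (r ω) v n m / optimalMeanReward (r ω) n ≤ ε := by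
  have hδ3 : 0 < δ / 3 := by positivity
  obtain ⟨c, hc, hB1⟩ := exists_measure_forall_le_le hxm hα hδ3
  -- The order of choice is `c`, then `η` with truncated sums below `ε * c * n ^ (2 / α)`, then `s`
  -- with no reward above level `η` in the strip.
  obtain ⟨η, hη, hB2⟩ := h.exists_truncation_level hxm hα hα2 (mul_pos hε hc) hδ3
  obtain ⟨s, hs, hB3⟩ := exists_measure_strip_le hxm hα hη hδ3
  refine ⟨⌈2 / s⌉₊ + 1, fun d => ENNReal.ofReal (2 * (d + 1) * Real.exp (-(s ^ 2 * d / 8))),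
    ?_, fun n => ?_⟩
  · have hs8 : 0 < s ^ 2 / 8 := by positivity
    have h1 := (Real.summable_pow_mul_exp_neg_nat_mul 1 hs8).add
      (Real.summable_pow_mul_exp_neg_nat_mul 0 hs8)
    refine Summable.tsum_ofReal_ne_top ((h1.mul_left 2).congr fun d => ?_)
    rw [pow_one, pow_zero, show -(s ^ 2 / 8) * (d : ℝ) = -(s ^ 2 * d / 8) by ring]
    ring
  · by_cases hn : 1 ≤ n ∧ 1 ≤ s * n
    swap
    · refine ⟨∅, by simp, fun m hm hD => absurd ?_ hn⟩
      have h1 : n / m ≤ n := Nat.div_le_self n m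
      have h2 : ⌈2 / s⌉₊ ≤ n := by omega
      have h3 := Nat.ceil_le.1 h2
      rw [div_le_iff₀ hs] at h3
      exact ⟨by omega, by linarith⟩
    obtain ⟨hn1, hsn⟩ := hn
    have hn0 : (0 : ℝ) < n := by exact_mod_cast hn1
    obtain ⟨B, hB, hB'⟩ := hB2 n hn1
    set t : ℝ := (n : ℝ) ^ (2 / α) with ht
    have ht0 : 0 < t := by positivity
    refine ⟨{ω | ¬ ∀ u, 0 < r ω u} ∪ ({ω | ∀ u, 1 ≤ layer u → layer u ≤ n → r ω u ≤ c * t} ∪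
      (B ∪ {ω | ∃ u, layer u ≤ n ∧ |drift u| ≤ s * n ∧ η * t < r ω u})), ?_, ?_⟩
    · refine (measure_union_le _ _).trans ?_
      rw [ae_iff.1 (h.ae_pos hxm), zero_add]
      calc _ ≤ ENNReal.ofReal (δ / 3) + (ENNReal.ofReal (δ / 3) + ENNReal.ofReal (δ / 3)) :=
            (measure_union_le _ _).trans (add_le_add (hB1 h hn1)
              ((measure_union_le _ _).trans (add_le_add hB (hB3 h hn1 hsn))))
        _ = ENNReal.ofReal δ := by
            rw [← ENNReal.ofReal_add hδ3.le hδ3.le, ← ENNReal.ofReal_add hδ3.le (by positivity)]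
            ring_nf
    · intro m hm hD
      refine ⟨_, h.measure_exists_isReachable_le hxm hα hm hs (d := n / m), ?_⟩
      intro ω hω hE v hv
      simp only [Set.mem_union, Set.mem_ofPred_eq, not_or, not_exists, not_forall,
        not_and, not_lt, not_le, exists_prop] at hω hE
      obtain ⟨hpos, ⟨u, hu1, hun, hu⟩, hωB, hstrip⟩ := hω
      set K := n / m with hK
      have hKm : K * m ≤ n := Nat.div_mul_le_self n m
      have hKm' : (m : ℝ) * K ≤ n := by rw [mul_comm]; exact_mod_cast hKm
      have hm0 : (0 : ℝ) < m := by exact_mod_cast hm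
      -- This is what `D` is for: the drift within one iteration uses half of the strip, the start
      -- vertices use the other half.
      have hmn : (m : ℝ) ≤ s * n / 2 := by
        have h1 : 2 / s ≤ K := Nat.ceil_le.1 (by omega)
        rw [div_le_iff₀ hs] at h1
        nlinarith
      obtain ⟨γ, hγ, hγv, hγr⟩ := hv.exists_isRoute hm
      have hsum : ∑ k ∈ Finset.range K, maxReward (r ω) (v k) m ≤ ε * c * t := by
        rw [hγr]
        refine hB' ω hωB γ hγ hpos _ hKm fun i hi => hstrip _ ?_ ?_
        · rw [hγ.layer_eq]; omega
        · have hdiv : (i + 1) / m * m + (i + 1) % m = i + 1 := by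
            rw [mul_comm]; exact Nat.div_add_mod (i + 1) m
          have hmod := Nat.mod_lt (i + 1) hm
          have hk : (i + 1) / m ≤ K := Nat.div_le_div_right (by omega)
          have h1 := hE _ hk _ (hv.isReachable _)
          have h2 := hγ.abs_drift_sub_le ((i + 1) / m * m) ((i + 1) % m)
          rw [hdiv, hγv] at h2
          have h3 : (((i + 1) % m : ℕ) : ℝ) ≤ m := by exact_mod_cast hmod.le
          have h4 := abs_sub_abs_le_abs_sub (drift (γ (i + 1))) (drift (v ((i + 1) / m)))
          have h5 : s * (m * K) ≤ s * n := mul_le_mul_of_nonneg_left hKm' hs.le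
          linarith
      have hnn : ∀ u, 0 ≤ r ω u := fun u => (hpos u).le
      have hmax : c * t < maxReward (r ω) (0, 0) n := hu.trans_le (le_maxReward_of_nonneg hnn hu1 hun)
      have hct : 0 < c * t := by positivity
      rw [iterativeMeanReward, optimalMeanReward, div_div_div_cancel_right₀ hn0.ne']
      refine ⟨div_nonneg (Finset.sum_nonneg fun k _ => maxReward_nonneg hnn _ _)
        (hct.trans hmax).le, ?_⟩
      rw [div_le_iff₀ (hct.trans hmax)]
      refine hsum.trans ?_
      rw [mul_assoc]
      exact mul_le_mul_of_nonneg_left hmax.le hε.le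

end IsParetoField

/-! ### Coupling by quantiles -/

/-- The quantile transform: every law on the line is an image of the uniform distribution under
the generalized inverse of its distribution function. -/
theorem exists_quantile (ν : Measure ℝ) [IsProbabilityMeasure ν] :
    ∃ Q : ℝ → ℝ, Measurable Q ∧ (volume.restrict (Set.Ioo 0 1)).map Q = ν ∧
      ∀ u ∈ Set.Ioo (0 : ℝ) 1, ∀ x, u ≤ cdf ν x → Q u ≤ x := by
  classical
  have hiff : ∀ u ∈ Set.Ioo (0 : ℝ) 1, ∀ x, sInf {x | u ≤ cdf ν x} ≤ x ↔ u ≤ cdf ν x := by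
    rintro u ⟨hu0, hu1⟩ x
    have hbdd : BddBelow {x | u ≤ cdf ν x} := by
      obtain ⟨y, hy⟩ := ((tendsto_cdf_atBot ν).eventually (gt_mem_nhds hu0)).exists
      exact ⟨y, fun z hz => le_of_not_gt fun hzy =>
        (lt_irrefl u) ((le_trans hz (monotone_cdf ν hzy.le)).trans_lt hy)⟩
    have hne : {x | u ≤ cdf ν x}.Nonempty := by
      obtain ⟨y, hy⟩ := ((tendsto_cdf_atTop ν).eventually (lt_mem_nhds hu1)).exists
      exact ⟨y, le_of_lt hy⟩
    refine ⟨fun h => ?_, fun h => csInf_le hbdd h⟩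
    refine le_trans ?_ (monotone_cdf ν h)
    -- Right-continuity shows that the infimum belongs to the set.
    have hr : Tendsto (cdf ν) (𝓝[>] sInf {x | u ≤ cdf ν x}) (𝓝 (cdf ν (sInf {x | u ≤ cdf ν x}))) :=
      ((cdf ν).right_continuous _).tendsto.mono_left (nhdsWithin_mono _ Set.Ioi_subset_Ici_self)
    refine ge_of_tendsto hr (eventually_nhdsWithin_of_forall fun y hy => ?_)
    obtain ⟨z, hz, hzy⟩ := (csInf_lt_iff hbdd hne).1 hy
    exact le_trans hz (monotone_cdf ν hzy.le)
  let Q : ℝ → ℝ := fun u => if u ∈ Set.Ioo (0 : ℝ) 1 then sInf {x | u ≤ cdf ν x} else 0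
  have hQ : ∀ u ∈ Set.Ioo (0 : ℝ) 1, ∀ x, Q u ≤ x ↔ u ≤ cdf ν x := fun u hu x => by
    simp only [Q, if_pos hu, hiff u hu x]
  have hQm : Measurable Q := by
    refine measurable_of_Iic fun x => ?_
    have h1 : Q ⁻¹' Set.Iic x = (Set.Ioo 0 1 ∩ Set.Iic (cdf ν x)) ∪ ((Set.Ioo 0 1)ᶜ ∩ {_u | 0 ≤ x}) := by
      ext u
      by_cases hu : u ∈ Set.Ioo (0 : ℝ) 1
      · simp only [Set.mem_preimage, Set.mem_Iic, hQ u hu x]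
        simp [hu]
      · simp only [Set.mem_preimage, Set.mem_Iic, Q, if_neg hu]
        simp [hu]
    rw [h1]
    exact (measurableSet_Ioo.inter measurableSet_Iic).union
      (measurableSet_Ioo.compl.inter (MeasurableSet.const _))
  have hprob : IsProbabilityMeasure (volume.restrict (Set.Ioo (0 : ℝ) 1)) := ⟨by simp⟩
  refine ⟨Q, hQm, ?_, fun u hu x => (hQ u hu x).2⟩
  refine Measure.ext_of_Iic _ _ fun x => ?_
  have h0 : 0 ≤ cdf ν x := cdf_nonneg ν x
  have h1 : cdf ν x ≤ 1 := cdf_le_one ν x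
  rw [Measure.map_apply hQm measurableSet_Iic, Measure.restrict_apply (hQm measurableSet_Iic),
    ← ofReal_cdf ν x]
  have h2 : Q ⁻¹' Set.Iic x ∩ Set.Ioo 0 1 = Set.Ioo 0 1 ∩ Set.Iic (cdf ν x) := by
    ext u
    simp only [Set.mem_inter_iff, Set.mem_preimage, Set.mem_Iic]
    exact ⟨fun ⟨h3, h4⟩ => ⟨h4, (hQ u h4 x).1 h3⟩, fun ⟨h3, h4⟩ => ⟨(hQ u h3 x).2 h4, h3⟩⟩
  rw [h2]
  refine le_antisymm ?_ ?_
  · refine (measure_mono (t := Set.Ioc 0 (cdf ν x)) fun u hu => ⟨hu.1.1, hu.2⟩).trans ?_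
    rw [Real.volume_Ioc, sub_zero]
  · refine le_trans (le_of_eq ?_) (measure_mono (s := Set.Ioo 0 (cdf ν x))
      fun u hu => ⟨⟨hu.1, hu.2.trans_le h1⟩, hu.2.le⟩)
    rw [Real.volume_Ioo, sub_zero]

/-- Random elements with a common law can be coupled so that, almost surely, the number of bad
events that occur at index `n` is bounded in `n`, provided that the probabilities of the bad events
decay geometrically, uniformly in `n`. -/
theorem exists_coupling {S : Type*} [MeasurableSpace S] [StandardBorelSpace S] (μ : Measure S)
    [IsProbabilityMeasure μ] {B : ℕ → ℕ → Set S} (hB : ∀ n i, MeasurableSet (B n i))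
    (hμ : ∀ n i, μ (B n i) ≤ ENNReal.ofReal ((1 / 2) ^ i)) :
    ∃ (Ω : Type) (_ : MeasurableSpace Ω) (P : Measure Ω) (X : ℕ → Ω → S),
      IsProbabilityMeasure P ∧ (∀ n, Measurable (X n)) ∧ (∀ n, P.map (X n) = μ) ∧
      ∀ᵐ ω ∂P, ∃ C : ℕ, ∀ n, ∀ F : Finset ℕ, (∀ i ∈ F, X n ω ∈ B n i) → F.card ≤ C := by
  have hS : Nonempty S := nonempty_of_isProbabilityMeasure μ
  have hg := measurableEmbedding_sigmoid_comp_embeddingReal S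
  set g : S → unitInterval := unitInterval.sigmoid ∘ embeddingReal S
  let f : ℕ → S → ℝ≥0∞ := fun n s => ∑' i, (B n i).indicator 1 s
  have hfm : ∀ n, Measurable (f n) := fun n =>
    Measurable.tsum fun i => measurable_const.indicator (hB n i)
  have hf2 : ∀ n, ∫⁻ s, f n s ∂μ ≤ 2 := by
    intro n
    calc ∫⁻ s, f n s ∂μ = ∑' i, μ (B n i) := by
          simp only [f]
          rw [lintegral_tsum (f := fun i => (B n i).indicator 1) fun i =>
            (measurable_const.indicator (hB n i)).aemeasurable]
          exact tsum_congr fun i => lintegral_indicator_one (hB n i)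
      _ ≤ ∑' i : ℕ, ENNReal.ofReal ((1 / 2) ^ i) := ENNReal.tsum_le_tsum (hμ n)
      _ = 2 := by
          rw [← ENNReal.ofReal_tsum_of_nonneg (fun i => by positivity) summable_geometric_two,
            tsum_geometric_two, ENNReal.ofReal_ofNat]
  -- A real code of `s`: the integer part records the number of bad events, the fractional part
  -- determines `s`. Halving keeps the fractional part below 1.
  let c : ℕ → S → ℝ := fun n s => (⌊(f n s).toReal⌋₊ : ℝ) + (g s : ℝ) / 2
  have hcm : ∀ n, Measurable (c n) := fun n =>
    ((measurable_from_nat (f := fun k : ℕ => (k : ℝ))).comp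
      (Nat.measurable_floor.comp (hfm n).ennreal_toReal)).add
      ((measurable_subtype_coe.comp hg.measurable).div_const 2)
  let dec : ℝ → S := fun x => hg.invFun (Set.projIcc 0 1 zero_le_one (2 * Int.fract x))
  have hdm : Measurable dec := hg.measurable_invFun.comp
    (continuous_projIcc.measurable.comp (measurable_fract.const_mul 2))
  have hdec : ∀ n s, dec (c n s) = s := by
    intro n s
    have h0 := (g s).2.1
    have h1 := (g s).2.2
    have h2 : Int.fract (c n s) = (g s : ℝ) / 2 := by
      simp only [c]
      rw [Int.fract_natCast_add, Int.fract_eq_self.2 ⟨by linarith, by linarith⟩]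
    simp only [dec, h2]
    rw [mul_div_cancel₀ _ (two_ne_zero' ℝ), Set.projIcc_val]
    exact hg.leftInverse_invFun s
  have hν : ∀ n, IsProbabilityMeasure (μ.map (c n)) := fun n =>
    Measure.isProbabilityMeasure_map (hcm n).aemeasurable
  choose Q hQm hQν hQle using fun n => exists_quantile (μ.map (c n))
  have hprob : IsProbabilityMeasure (volume.restrict (Set.Ioo (0 : ℝ) 1)) := ⟨by simp⟩
  have hlaw : ∀ n, (volume.restrict (Set.Ioo (0 : ℝ) 1)).map (fun u => dec (Q n u)) = μ := by
    intro n
    calc _ = ((volume.restrict (Set.Ioo (0 : ℝ) 1)).map (Q n)).map dec :=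
          (Measure.map_map hdm (hQm n)).symm
      _ = μ.map (dec ∘ c n) := by rw [hQν, Measure.map_map hdm (hcm n)]
      _ = μ := by
          have : dec ∘ c n = id := funext (hdec n)
          rw [this, Measure.map_id]
  refine ⟨ℝ, inferInstance, volume.restrict (Set.Ioo 0 1), fun n u => dec (Q n u), hprob,
    fun n => hdm.comp (hQm n), hlaw, ?_⟩
  have hae1 : ∀ᵐ u ∂volume.restrict (Set.Ioo (0 : ℝ) 1), ∀ n, c n (dec (Q n u)) = Q n u := by
    refine ae_all_iff.2 fun n => ?_
    refine ae_of_ae_map (hQm n).aemeasurable (p := fun y => c n (dec y) = y) ?_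
    rw [hQν]
    refine (ae_map_iff (hcm n).aemeasurable
      (measurableSet_eq_fun ((hcm n).comp hdm) measurable_id)).2 (ae_of_all _ fun s => ?_)
    exact congrArg (c n) (hdec n s)
  have hae2 : ∀ᵐ u ∂volume.restrict (Set.Ioo (0 : ℝ) 1), ∀ n, f n (dec (Q n u)) < ∞ := by
    refine ae_all_iff.2 fun n => ?_
    refine ae_of_ae_map (hdm.comp (hQm n)).aemeasurable (p := fun s => f n s < ∞) ?_
    have := hlaw n
    rw [show (dec ∘ Q n) = fun u => dec (Q n u) from rfl, this]
    exact ae_lt_top (hfm n) ((hf2 n).trans_lt ENNReal.ofNat_lt_top).ne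
  filter_upwards [hae1, hae2, ae_restrict_mem measurableSet_Ioo] with u hu1 hu2 hu
  have hu' : 0 < 1 - u := by linarith [hu.2]
  set a : ℝ := 2 / (1 - u) with ha
  have ha0 : 0 < a := by positivity
  -- Markov's inequality with mean 2 gives tail at most `2 / a = 1 - u`, so the `u`-quantile is
  -- bounded by a number that does not depend on `n`.
  have hQa : ∀ n, Q n u ≤ a + 1 := by
    intro n
    refine hQle n u hu _ ?_
    have h1 : μ.map (c n) (Set.Ioi (a + 1)) ≤ ENNReal.ofReal (1 - u) := by
      rw [Measure.map_apply (hcm n) measurableSet_Ioi]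
      calc μ (c n ⁻¹' Set.Ioi (a + 1)) ≤ μ {s | ENNReal.ofReal a ≤ f n s} := by
            refine measure_mono fun s hs => ?_
            have h2 : a + 1 < c n s := hs
            have h3 : (⌊(f n s).toReal⌋₊ : ℝ) ≤ (f n s).toReal := Nat.floor_le ENNReal.toReal_nonneg
            have h4 := (g s).2.2
            exact ENNReal.ofReal_le_of_le_toReal (by simp only [c] at h2; linarith)
        _ ≤ (∫⁻ s, f n s ∂μ) / ENNReal.ofReal a :=
            meas_ge_le_lintegral_div (hfm n).aemeasurable (by simpa using ha0)
              ENNReal.ofReal_ne_top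
        _ ≤ ENNReal.ofReal (1 - u) := by
            refine ENNReal.div_le_of_le_mul ((hf2 n).trans (le_of_eq ?_))
            rw [← ENNReal.ofReal_mul hu'.le, ha, mul_div_cancel₀ _ hu'.ne', ENNReal.ofReal_ofNat]
    have h2 := ENNReal.toReal_le_of_le_ofReal hu'.le h1
    have h3 := probReal_compl_eq_one_sub (μ := μ.map (c n)) (measurableSet_Ioi (a := a + 1))
    rw [cdf_eq_real, ← Set.compl_Ioi, h3]
    simp only [measureReal_def]
    linarith
  refine ⟨⌈a + 1⌉₊, fun n F hF => ?_⟩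
  set s := dec (Q n u) with hs
  have h1 : (F.card : ℝ≥0∞) ≤ f n s := by
    calc (F.card : ℝ≥0∞) = ∑ i ∈ F, (B n i).indicator 1 s := by
          rw [Finset.sum_congr rfl fun i hi => Set.indicator_of_mem (hF i hi) _]
          simp
      _ ≤ f n s := ENNReal.sum_le_tsum F
  have h2 : (F.card : ℝ) ≤ (f n s).toReal := by
    have := ENNReal.toReal_mono (hu2 n).ne h1
    simpa using this
  have h3 : (F.card : ℝ) ≤ ⌊(f n s).toReal⌋₊ := by exact_mod_cast Nat.le_floor h2
  have h4 : c n s ≤ a + 1 := (hu1 n).le.trans (hQa n)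
  have h5 := (g s).2.1
  have h6 : (F.card : ℝ) ≤ ⌈a + 1⌉₊ := by
    refine le_trans ?_ (Nat.le_ceil _)
    simp only [c] at h4
    linarith
  exact_mod_cast h6

/-! ### Uniformity in the sensing range, and the two limits -/

theorem IsSublinear.tendsto_div {M : ℕ → ℕ} (h : IsSublinear M) (hM : ∀ n, 1 ≤ n → 1 ≤ M n) :
    Tendsto (fun n => n / M n) atTop atTop := by
  refine tendsto_atTop.2 fun D => ?_
  have hD : (0 : ℝ) < 1 / (D + 1) := by positivity
  filter_upwards [(show Tendsto _ _ _ from h).eventually (gt_mem_nhds hD), eventually_ge_atTop 1]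
    with n hn hn1
  have hn0 : (0 : ℝ) < n := by exact_mod_cast hn1
  rw [div_lt_div_iff₀ hn0 (by positivity), one_mul] at hn
  have h1 : M n * (D + 1) < n := by exact_mod_cast hn
  exact (Nat.le_div_iff_mul_le (hM n hn1)).2 (by nlinarith)

/-- Bad events for all sensing ranges that divide `n` simultaneously. -/
theorem IsParetoField.exists_uniform_bad_events {Ω : Type*} [MeasurableSpace Ω] {P : Measure Ω}
    {xm α : ℝ} {r : Ω → ℕ × ℕ → ℝ} (h : IsParetoField P xm α r) (hxm : 0 < xm) (hα : 0 < α)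
    (hα2 : α < 2) {ε δ : ℝ} (hε : 0 < ε) (hδ : 0 < δ) :
    ∃ (D : ℕ) (B : ℕ → Set Ω), (∀ n, MeasurableSet (B n)) ∧ (∀ n, P (B n) ≤ ENNReal.ofReal δ) ∧
      ∀ n m, 1 ≤ n → 1 ≤ m → m ∣ n → D ≤ n / m → ∀ ω, ω ∉ B n → ∀ v, IsPlannerRun (r ω) m v →
        |iterativeMeanReward (r ω) v n m / optimalMeanReward (r ω) n| ≤ ε := by
  have hδ2 : 0 < δ / 2 := by positivity
  obtain ⟨D, e, he, hB⟩ := h.exists_bad_events hxm hα hα2 hε hδ2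
  choose B hB1 hB2 using hB
  obtain ⟨D', hD'⟩ := ((ENNReal.tendsto_sum_nat_add e he).eventually
    (gt_mem_nhds (ENNReal.ofReal_pos.2 hδ2))).exists
  -- The events are indexed by `d = n / m`. As `m` divides `n`, `d` determines `m`, so the union
  -- over all `m` costs a tail of the convergent series.
  have hE : ∀ n d, ∃ E : Set Ω, P E ≤ e d ∧ (1 ≤ n → d ∣ n → D ≤ d → ∀ ω, ω ∉ B n → ω ∉ E →
      ∀ v, IsPlannerRun (r ω) (n / d) v →
        |iterativeMeanReward (r ω) v n (n / d) / optimalMeanReward (r ω) n| ≤ ε) := by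
    intro n d
    by_cases hnd : 1 ≤ n ∧ d ∣ n ∧ D ≤ d
    · obtain ⟨hn, hd, hD⟩ := hnd
      have h1 : n / (n / d) = d := Nat.div_div_self hd (by omega)
      have h2 : 1 ≤ n / d := Nat.div_pos (Nat.le_of_dvd hn hd) (Nat.pos_of_dvd_of_pos hd hn)
      obtain ⟨E, hE1, hE2⟩ := hB2 n (n / d) h2 (h1.symm ▸ hD)
      rw [h1] at hE1
      refine ⟨E, hE1, fun _ _ _ ω hω hωE v hv => ?_⟩
      obtain ⟨h3, h4⟩ := hE2 ω hω hωE v hv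
      rwa [abs_of_nonneg h3]
    · exact ⟨∅, by simp, fun h1 h2 h3 => absurd ⟨h1, h2, h3⟩ hnd⟩
  choose E hE1 hE2 using hE
  refine ⟨max D D', fun n => toMeasurable P (B n ∪ ⋃ k, E n (k + D')),
    fun n => measurableSet_toMeasurable _ _, fun n => ?_, ?_⟩
  · rw [measure_toMeasurable]
    calc P (B n ∪ ⋃ k, E n (k + D')) ≤ P (B n) + ∑' k, P (E n (k + D')) :=
          (measure_union_le _ _).trans (add_le_add le_rfl (measure_iUnion_le _))
      _ ≤ ENNReal.ofReal (δ / 2) + ENNReal.ofReal (δ / 2) :=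
          add_le_add (hB1 n) ((ENNReal.tsum_le_tsum fun k => hE1 n _).trans hD'.le)
      _ = ENNReal.ofReal δ := by rw [← ENNReal.ofReal_add hδ2.le hδ2.le, add_halves]
  · intro n m hn hm hmn hD ω hω v hv
    have h1 : n / (n / m) = m := Nat.div_div_self hmn (by omega)
    have hω' : ω ∉ B n ∪ ⋃ k, E n (k + D') := fun h => hω (subset_toMeasurable _ _ h)
    have h2 : ω ∉ E n (n / m) := fun hωE => hω' (Or.inr (Set.mem_iUnion.2
      ⟨n / m - D', by rwa [Nat.sub_add_cancel ((le_max_right _ _).trans hD)]⟩))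
    have h3 := hE2 n (n / m) hn (Nat.div_dvd_of_dvd hmn) ((le_max_left _ _).trans hD) ω
      (fun h => hω' (Or.inl h)) h2
    rw [h1] at h3
    exact h3 v hv

/-- Level `i` has accuracy `1 / (i + 1)` and failure probability `(1 / 2) ^ i`. The coupled fields
are chosen before `M`, and so is the exceptional null set. -/
theorem exists_coupled_fields_tendsto {xm α : ℝ} (hxm : 0 < xm) (hα : 0 < α) (hα2 : α < 2) :
    ∃ (Ω : Type) (_ : MeasurableSpace Ω) (P : Measure Ω) (r : ℕ → Ω → ℕ × ℕ → ℝ),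
      IsProbabilityMeasure P ∧ (∀ n, IsParetoField P xm α (r n)) ∧
      ∀ M : ℕ → ℕ, (∀ n, 1 ≤ n → 1 ≤ M n) → IsSublinear M →
        ∀ v : ℕ → Ω → ℕ → ℕ × ℕ, (∀ n ω, IsPlannerRun (r n ω) (M n) (v n ω)) →
          ∀ᵐ ω ∂P, Tendsto (fun n => iterativeMeanReward (r n ω) (v n ω) n (M n) /
            optimalMeanReward (r n ω) n) (atTop ⊓ 𝓟 {n | M n ∣ n}) (𝓝 0) := by
  have hp := isProbabilityMeasure_paretoMeasure hxm hα
  set μ := Measure.infinitePi fun _ : ℕ × ℕ => paretoMeasure xm α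
  have hμ : IsParetoField μ xm α id := isParetoField_id hxm hα
  choose D B hB1 hB2 hB3 using fun i : ℕ => hμ.exists_uniform_bad_events hxm hα hα2
    (ε := 1 / ((i : ℝ) + 1)) (δ := (1 / 2) ^ i) (by positivity) (by positivity)
  obtain ⟨Ω, _, P, X, hP, hX, hlaw, hC⟩ := exists_coupling μ (B := fun n i => B i n)
    (fun n i => hB1 i n) (fun n i => hB2 i n)
  refine ⟨Ω, inferInstance, P, X, hP, fun n => .of_map_eq hxm hα (hX n) (hlaw n), ?_⟩
  intro M hM hsub v hv
  filter_upwards [hC] with ω hω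
  obtain ⟨C, hC⟩ := hω
  refine Metric.tendsto_nhds.2 fun ε hε => ?_
  obtain ⟨i₀, hi₀⟩ := exists_nat_one_div_lt hε
  rw [eventually_inf_principal]
  filter_upwards [(hsub.tendsto_div hM).eventually_ge_atTop
    ((Finset.Icc i₀ (i₀ + C)).sup D), eventually_ge_atTop 1] with n hn hn1 hdvd
  -- At most `C` levels fail, so one of the `C + 1` levels from `i₀` on succeeds.
  obtain ⟨i, hi, hiB⟩ : ∃ i ∈ Finset.Icc i₀ (i₀ + C), X n ω ∉ B i n := by
    by_contra! hcon
    have := hC n _ hcon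
    rw [Nat.card_Icc] at this
    omega
  have h1 := hB3 i n (M n) hn1 (hM n hn1) hdvd ((Finset.le_sup hi).trans hn) (X n ω) hiB _ (hv n ω)
  rw [Real.dist_eq, sub_zero]
  refine (h1.trans ?_).trans_lt hi₀
  have h2 : (i₀ : ℝ) ≤ i := by exact_mod_cast (Finset.mem_Icc.1 hi).1
  exact one_div_le_one_div_of_le (by positivity) (by linarith)

/-- Only one sensing range occurs for each `n`, so no union over `m`, and hence no divisibility, is
needed. -/
theorem IsParetoField.tendstoInMeasure {Ω : Type*} [MeasurableSpace Ω] {P : Measure Ω}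
    {xm α : ℝ} {r : Ω → ℕ × ℕ → ℝ} (h : IsParetoField P xm α r) (hxm : 0 < xm) (hα : 0 < α)
    (hα2 : α < 2) {M : ℕ → ℕ} (hM : ∀ n, 1 ≤ n → 1 ≤ M n) (hsub : IsSublinear M)
    {v : ℕ → Ω → ℕ → ℕ × ℕ} (hv : ∀ n ω, IsPlannerRun (r ω) (M n) (v n ω)) :
    TendstoInMeasure P (fun n ω => iterativeMeanReward (r ω) (v n ω) n (M n) /
      optimalMeanReward (r ω) n) atTop (fun _ => 0) := by
  refine tendstoInMeasure_iff_norm.2 fun ε hε => ?_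
  refine ENNReal.tendsto_nhds_zero.2 fun δ hδ => ?_
  obtain ⟨δ', hδ'0, hδ'⟩ : ∃ δ' : ℝ, 0 < δ' ∧ ENNReal.ofReal δ' + ENNReal.ofReal δ' ≤ δ := by
    obtain ⟨x, hx0, hx⟩ := ENNReal.lt_iff_exists_nnreal_btwn.1 hδ
    have hx0' : (0 : ℝ) < x := by exact_mod_cast hx0
    refine ⟨x / 2, by positivity, ?_⟩
    rw [← ENNReal.ofReal_add (by positivity) (by positivity), add_halves,
      ENNReal.ofReal_coe_nnreal]
    exact hx.le
  obtain ⟨D, e, he, hB⟩ := h.exists_bad_events hxm hα hα2 (half_pos hε) hδ'0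
  have he0 : Tendsto (fun n => e (n / M n)) atTop (𝓝 0) :=
    (ENNReal.tendsto_atTop_zero_of_tsum_ne_top he).comp (hsub.tendsto_div hM)
  filter_upwards [(hsub.tendsto_div hM).eventually_ge_atTop D, eventually_ge_atTop 1,
    he0.eventually (gt_mem_nhds (ENNReal.ofReal_pos.2 hδ'0))] with n hn hn1 hen
  obtain ⟨B, hB1, hB2⟩ := hB n
  obtain ⟨E, hE1, hE2⟩ := hB2 (M n) (hM n hn1) hn
  refine le_trans (le_trans (measure_mono (t := B ∪ E) fun ω hω => ?_) (measure_union_le _ _))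
    ((add_le_add hB1 (hE1.trans hen.le)).trans hδ')
  by_contra hcon
  rw [Set.mem_union, not_or] at hcon
  obtain ⟨h1, h2⟩ := hE2 ω hcon.1 hcon.2 _ (hv n ω)
  have h3 : ε ≤ ‖iterativeMeanReward (r ω) (v n ω) n (M n) / optimalMeanReward (r ω) n - 0‖ := hω
  rw [sub_zero, Real.norm_eq_abs, abs_of_nonneg h1] at h3
  linarith

theorem mainTheorem2 (xm α : ℝ) (hxm : 0 < xm) (hα : 0 < α) (hα2 : α < 2) :
    (∃ (Ω : Type) (_ : MeasurableSpace Ω) (P : Measure Ω) (r : ℕ → Ω → ℕ × ℕ → ℝ),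
      IsProbabilityMeasure P ∧ (∀ n, IsParetoField P xm α (r n)) ∧
      ∀ M : ℕ → ℕ, (∀ n, 1 ≤ n → 1 ≤ M n) → IsSublinear M →
        ∀ v : ℕ → Ω → ℕ → ℕ × ℕ, (∀ n ω, IsPlannerRun (r n ω) (M n) (v n ω)) →
          ∀ᵐ ω ∂P, Tendsto (fun n => iterativeMeanReward (r n ω) (v n ω) n (M n) /
            optimalMeanReward (r n ω) n) (atTop ⊓ 𝓟 {n | M n ∣ n}) (𝓝 0)) ∧
    (∀ (Ω : Type*) (_ : MeasurableSpace Ω) (P : Measure Ω) (r : Ω → ℕ × ℕ → ℝ),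
      IsProbabilityMeasure P → IsParetoField P xm α r →
      ∀ M : ℕ → ℕ, (∀ n, 1 ≤ n → 1 ≤ M n) → IsSublinear M →
        ∀ v : ℕ → Ω → ℕ → ℕ × ℕ, (∀ n ω, IsPlannerRun (r ω) (M n) (v n ω)) →
          TendstoInMeasure P (fun n ω => iterativeMeanReward (r ω) (v n ω) n (M n) /
            optimalMeanReward (r ω) n) atTop (fun _ => 0)) := by
  refine ⟨exists_coupled_fields_tendsto hxm hα hα2, ?_⟩
  intro Ω _ P r _ h M hM hsub v hv
  exact h.tendstoInMeasure hxm hα hα2 hM hsub hv
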